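/- **Setting.** Let $N\ge 2$, $d\ge 1$, $l,r,m\ge 0$ be integers, and let $\omega$ be a state (density matrix) on a chain with sites $1,\dots,N$ and local algebra $\mathcal A=\mathbb M_d(\mathbb C)$, $d_{\mathcal A}=d$; no translation invariance is assumed. Intervals of sites are always intersected with $[1,N]$, and $\omega_I$ is the marginal of $\omega$ on $I$. For $i\le j+1$, $j\le k$ let $\Omega^{[i,j,k]}:\mathcal A_{[j+1,k]}\to\mathcal A_{[i,j]}^*$ be $\Omega^{[i,j,k]}[X](Y)=\omega(\mathbb 1\otimes Y\otimes X\otimes\mathbb 1)$, and for $A\in\mathcal A_j$ let $\Omega_A^{[i,j-1,k]}[X](Y)=\omega(\mathbb 1\otimes Y\otimes A\otimes X\otimes\mathbb 1)$ with $Y\in\mathcal A_{[i,j-1]}$, $X\in\mathcal A_{[j+1,k]}$; all spaces carry the Hilbert--Schmidt inner product. Assume that $\omega$ is $(l,r,m)$-finitely correlated: for all $0\le j\le N$, $$\operatorname{rank}\Omega^{[1,j,N]}=\operatorname{rank}\Omega^{[j-l+1,j,j+r]}=:m_j\le m .$$ Let $\sigma_j>0$ be the smallest nonzero singular value ($=\sigma_{m_j}$)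 of $\Omega^{[j-l+1,j,j+r]}$. **Spectral reconstruction.** Suppose matrices $\hat\omega_{[j-l+1,j+r]}$ $(0\le j\le N)$ and $\hat\omega_{[j-l,j+r]}$ $(1\le j\le N)$ are given as estimates of the corresponding marginals of $\omega$, and let $\hat\Omega^{[j-l+1,j,j+r]}$, $\hat\Omega_A^{[j-l,j-1,j+r]}$ be the maps defined as above from these estimates. Given a threshold $\eta$, take for $1\le j\le N-1$ any singular value decomposition of $\hat\Omega^{[j-l+1,j,j+r]}$ and let $\hat U_j$ consist of the left singular vectors with singular value $\ge\eta$. With $^+$ the Moore--Penrose inverse, set $$\hat{\mathbb K}^{(1)}_A=\hat\Omega^{[1,0,1+r]}_A(\hat U_1^\dagger\hat\Omega^{[2-l,1,1+r]})^+,\qquad \hat{\mathbb K}^{(N)}_A=\hat U_{N-1}^\dagger\hat\Omega_A^{[N-l,N-1,N]},$$ $$\hat{\mathbb K}^{(j)}_A=\hat U_{j-1}^\dagger\hat\Omega_A^{[j-l,j-1,j+r]}(\hat U_j^\dagger\hat\Omega^{[j-l+1,j,j+r]})^+\quad(2\le j\le N-1),$$ and let $\hat\omega$ be the linear functional with $\hat\omega(X_1\otimes\cdots\otimes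 X_N)=\hat{\mathbb K}^{(1)}_{X_1}\cdots\hat{\mathbb K}^{(N)}_{X_N}$. Write $d_{\mathrm{Tr}}(\hat\omega,\omega)=\tfrac12\|\hat\omega-\omega\|_1$, where $\|\varphi\|_1=\sup_{\|X\|_\infty\le 1}|\varphi(X)|$. **Theorem.** Let $0<\epsilon<1$ and $$\varepsilon=\min_{1\le j\le N}\frac{\epsilon\,\sigma_j^3}{20\,N\,m\,\sqrt{d_{\mathcal A}}},\qquad \min_{0\le j\le N}\frac{\sigma_j}{2}\ \ge\ \eta\ \ge\ 2\varepsilon .$$ 1. If all the estimates satisfy $\|\hat\omega_{[j-l+1,j+r]}-\omega_{[j-l+1,j+r]}\|_2\le\varepsilon$ $(0\le j\le N)$ and $\|\hat\omega_{[j-l,j+r]}-\omega_{[j-l,j+r]}\|_2\le\varepsilon$ $(1\le j\le N)$ in Hilbert--Schmidt norm, then the spectral reconstruction with threshold $\eta$ satisfies $d_{\mathrm{Tr}}(\hat\omega,\omega)\le\epsilon$. 2. Consequently there is a learning algorithm measuring only marginals on blocks of at most $l+r+1$ consecutive sites: consider any (possibly collective) measurement with finitely many outcomes on $n$ copies of $\omega$,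 touching on each copy only a block of at most $l+r+1$ consecutive sites, together with a rule that turns its outcome into estimates of the marginals above. Whenever, with probability at least $1-\delta$, all these estimates are $\varepsilon$-accurate in Hilbert--Schmidt distance (that is, whenever the $n$ copies suffice to learn the marginals at precision $\varepsilon$), the spectral reconstruction with threshold $\eta$ computed from the estimates satisfies $d_{\mathrm{Tr}}(\hat\omega,\omega)\le\epsilon$ with probability at least $1-\delta$. -/

import Mathlib

namespace FinChain

open Matrix
open scoped ComplexOrder

/-! ### Linear algebra: Moore-Penrose inverse, singular value decomposition, norms -/

section LinearAlgebra

variable {a b : Type} [Fintype a] [Fintype b] [DecidableEq b]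

/-- A (thin) singular value decomposition `M = U diag(s) Vᴴ`, where `U` and `V` have orthonormal
columns and `s` has nonnegative entries. -/
structure SVD (M : Matrix a b ℂ) where
  size : ℕ
  U : Matrix a (Fin size) ℂ
  s : Fin size → ℝ
  V : Matrix b (Fin size) ℂ
  U_orthonormal : Uᴴ * U = 1
  V_orthonormal : Vᴴ * V = 1
  s_nonneg : ∀ i, 0 ≤ s i
  decomp : M = U * diagonal (fun i => (s i : ℂ)) * Vᴴ

theorem SVD.nonempty (M : Matrix a b ℂ) : Nonempty (SVD M) := by
  classical
  have hH : (Mᴴ * M).IsHermitian := isHermitian_conjTranspose_mul_self M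
  set W : Matrix b b ℂ := (hH.eigenvectorUnitary : Matrix b b ℂ) with hW
  have hWW : Wᴴ * W = 1 := by
    have := Unitary.coe_star_mul_self hH.eigenvectorUnitary
    simpa [hW, star_eq_conjTranspose] using this
  have hWW' : W * Wᴴ = 1 := by
    have := Unitary.coe_mul_star_self hH.eigenvectorUnitary
    simpa [hW, star_eq_conjTranspose] using this
  have hpos : ∀ i, 0 ≤ hH.eigenvalues i := (posSemidef_conjTranspose_mul_self M).eigenvalues_nonneg
  have hspec : Wᴴ * (Mᴴ * M) * W = diagonal (fun i => (hH.eigenvalues i : ℂ)) := by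
    have h1 : Mᴴ * M = W * diagonal (fun i => (hH.eigenvalues i : ℂ)) * Wᴴ := by
      have := hH.spectral_theorem
      rw [Unitary.conjStarAlgAut_apply] at this
      simpa [hW, star_eq_conjTranspose, Function.comp_def] using this
    calc Wᴴ * (Mᴴ * M) * W
        = Wᴴ * (W * diagonal (fun i => (hH.eigenvalues i : ℂ)) * Wᴴ) * W :=
          congrArg (fun Z => Wᴴ * Z * W) h1
      _ = (Wᴴ * W) * diagonal (fun i => (hH.eigenvalues i : ℂ)) * (Wᴴ * W) := by
          simp only [Matrix.mul_assoc]
      _ = _ := by rw [hWW]; simp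
  set B : Matrix a b ℂ := M * W with hB
  have hBB : Bᴴ * B = diagonal (fun i => (hH.eigenvalues i : ℂ)) := by
    rw [← hspec, hB, conjTranspose_mul]; simp only [Matrix.mul_assoc]
  have hBM : B * Wᴴ = M := by rw [hB, Matrix.mul_assoc, hWW', Matrix.mul_one]
  have hB0 : ∀ i, hH.eigenvalues i = 0 → ∀ x, B x i = 0 := by
    intro i hi x
    have h1 : (Bᴴ * B) i i = 0 := by rw [hBB]; simp [hi]
    rw [Matrix.mul_apply] at h1
    have h2 : ∑ y, ‖B y i‖ ^ 2 = 0 := by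
      have : ((∑ y, ‖B y i‖ ^ 2 : ℝ) : ℂ) = 0 := by
        rw [← h1]; push_cast
        refine Finset.sum_congr rfl fun y _ => ?_
        rw [conjTranspose_apply, RCLike.star_def, Complex.conj_mul']
      exact_mod_cast this
    have h3 := (Finset.sum_eq_zero_iff_of_nonneg (fun y _ => by positivity)).1 h2 x
      (Finset.mem_univ x)
    simpa using h3
  let K := {i : b // hH.eigenvalues i ≠ 0}
  let e : Fin (Fintype.card K) ≃ K := (Fintype.equivFin K).symm
  refine ⟨⟨Fintype.card K,
    of fun x i => B x (e i).1 * ((√(hH.eigenvalues (e i).1) : ℝ) : ℂ)⁻¹,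
    fun i => √(hH.eigenvalues (e i).1), of fun x i => W x (e i).1, ?_, ?_, ?_, ?_⟩⟩
  · ext i j
    have h := congrFun (congrFun hBB (e i).1) (e j).1
    rw [Matrix.mul_apply] at h ⊢
    have hij : ∀ x, (of fun x i => B x (e i).1 * ((√(hH.eigenvalues (e i).1) : ℝ) : ℂ)⁻¹)ᴴ i x *
        (of fun x i => B x (e i).1 * ((√(hH.eigenvalues (e i).1) : ℝ) : ℂ)⁻¹) x j
        = (Bᴴ (e i).1 x * B x (e j).1) * (((√(hH.eigenvalues (e i).1) : ℝ) : ℂ)⁻¹ *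
          ((√(hH.eigenvalues (e j).1) : ℝ) : ℂ)⁻¹) := by
      intro x
      simp only [conjTranspose_apply, of_apply, star_mul', RCLike.star_def, map_inv₀,
        Complex.conj_ofReal]
      ring
    rw [Finset.sum_congr rfl fun x _ => hij x, ← Finset.sum_mul, h]
    by_cases hij : i = j
    · subst hij
      have hne := (e i).2
      have hsq : ((√(hH.eigenvalues (e i).1) : ℝ) : ℂ) * ((√(hH.eigenvalues (e i).1) : ℝ) : ℂ)
          = (hH.eigenvalues (e i).1 : ℂ) := by
        exact_mod_cast congrArg (fun t : ℝ => (t : ℂ)) (Real.mul_self_sqrt (hpos (e i).1))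
      rw [diagonal_apply_eq, one_apply_eq, ← mul_inv, hsq]
      exact mul_inv_cancel₀ (by exact_mod_cast hne)
    · have : (e i).1 ≠ (e j).1 := fun h => hij (e.injective (Subtype.ext h))
      rw [diagonal_apply_ne _ this, one_apply_ne hij, zero_mul]
  · ext i j
    have h := congrFun (congrFun hWW (e i).1) (e j).1
    rw [Matrix.mul_apply] at h ⊢
    refine Eq.trans (Finset.sum_congr rfl fun x _ => ?_) (h.trans ?_)
    · simp [conjTranspose_apply]
    · by_cases hij : i = j
      · subst hij; simp
      · have : (e i).1 ≠ (e j).1 := fun h => hij (e.injective (Subtype.ext h))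
        rw [one_apply_ne this, one_apply_ne hij]
  · intro i; positivity
  · ext x y
    conv_lhs => rw [← hBM]
    rw [Matrix.mul_apply, Matrix.mul_apply]
    have hsub : ∑ i : b, B x i * Wᴴ i y = ∑ i : K, B x i.1 * Wᴴ i.1 y := by
      have h1 : ∑ i : b, B x i * Wᴴ i y
          = ∑ i ∈ Finset.univ.filter (fun i => hH.eigenvalues i ≠ 0), B x i * Wᴴ i y := by
        symm
        apply Finset.sum_subset (Finset.filter_subset _ _)
        intro i _ hi
        have : hH.eigenvalues i = 0 := by simpa using hi
        rw [hB0 i this x, zero_mul]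
      rw [h1]
      exact Finset.sum_subtype _ (by simp) _
    rw [hsub, ← e.sum_comp]
    refine Finset.sum_congr rfl fun i _ => ?_
    have hne : ((√(hH.eigenvalues (e i).1) : ℝ) : ℂ) ≠ 0 := by
      have := Real.sqrt_pos.2 (lt_of_le_of_ne (hpos (e i).1) (Ne.symm (e i).2))
      exact_mod_cast this.ne'
    rw [mul_diagonal]
    simp only [of_apply, conjTranspose_apply]
    rw [inv_mul_cancel_right₀ hne]

/-- The columns of `U` that belong to the singular values `≥ η`. -/
def SVD.truncatedU {M : Matrix a b ℂ} (D : SVD M) (η : ℝ) :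
    Matrix a {i : Fin D.size // η ≤ D.s i} ℂ :=
  D.U.submatrix id Subtype.val

/-- The four Moore-Penrose conditions. -/
structure IsMoorePenrose (M : Matrix a b ℂ) (P : Matrix b a ℂ) : Prop where
  mul_mul_self : M * P * M = M
  mul_mul_inv : P * M * P = P
  left_hermitian : (M * P)ᴴ = M * P
  right_hermitian : (P * M)ᴴ = P * M

theorem exists_isMoorePenrose (M : Matrix a b ℂ) : ∃ P, IsMoorePenrose M P := by
  obtain ⟨⟨p, U, σ, V, hU, hV, -, hM⟩⟩ := SVD.nonempty M
  set S : Matrix (Fin p) (Fin p) ℂ := diagonal (fun i => (σ i : ℂ)) with hS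
  set T : Matrix (Fin p) (Fin p) ℂ := diagonal (fun i => (σ i : ℂ)⁻¹) with hT
  have hU' : ∀ {c : Type} [Fintype c] (X : Matrix (Fin p) c ℂ), Uᴴ * (U * X) = X := by
    intro c _ X; rw [← Matrix.mul_assoc, hU, Matrix.one_mul]
  have hV' : ∀ {c : Type} [Fintype c] (X : Matrix (Fin p) c ℂ), Vᴴ * (V * X) = X := by
    intro c _ X; rw [← Matrix.mul_assoc, hV, Matrix.one_mul]
  have hSTS : S * (T * S) = S := by
    rw [hS, hT, diagonal_mul_diagonal, diagonal_mul_diagonal]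
    congr 1; ext i
    by_cases h : (σ i : ℂ) = 0
    · simp [h]
    · field_simp
  have hTST : T * (S * T) = T := by
    rw [hS, hT, diagonal_mul_diagonal, diagonal_mul_diagonal]
    congr 1; ext i
    by_cases h : (σ i : ℂ) = 0
    · simp [h]
    · field_simp
  have hSc : Sᴴ = S := by
    rw [hS, diagonal_conjTranspose]; congr 1; ext i; simp
  have hTc : Tᴴ = T := by
    rw [hT, diagonal_conjTranspose]; congr 1; ext i; simp
  have hST : S * T = T * S := by
    rw [hS, hT, diagonal_mul_diagonal, diagonal_mul_diagonal]
    congr 1; ext i; exact mul_comm _ _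
  have hMP : M * (V * T * Uᴴ) = U * (S * T) * Uᴴ := by
    rw [hM]; simp only [Matrix.mul_assoc, hV']
  have hPM : (V * T * Uᴴ) * M = V * (T * S) * Vᴴ := by
    rw [hM]; simp only [Matrix.mul_assoc, hU']
  refine ⟨V * T * Uᴴ, ?_, ?_, ?_, ?_⟩
  · rw [Matrix.mul_assoc, hPM]
    conv_lhs => rw [hM]
    conv_rhs => rw [hM, ← hSTS]
    simp only [Matrix.mul_assoc, hV']
  · rw [Matrix.mul_assoc, hMP]
    conv_rhs => rw [← hTST]
    simp only [Matrix.mul_assoc, hU']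
  · rw [hMP]
    simp only [conjTranspose_mul, conjTranspose_conjTranspose, hSc, hTc, ← hST, Matrix.mul_assoc]
  · rw [hPM]
    simp only [conjTranspose_mul, conjTranspose_conjTranspose, hSc, hTc, ← hST, Matrix.mul_assoc]

/-- The Moore-Penrose pseudo-inverse `M⁺`. -/
noncomputable def pinv (M : Matrix a b ℂ) : Matrix b a ℂ :=
  (exists_isMoorePenrose M).choose

theorem pinv_isMoorePenrose (M : Matrix a b ℂ) : IsMoorePenrose M (pinv M) :=
  (exists_isMoorePenrose M).choose_spec

/-- The smallest nonzero singular value of `M`, that is `σ_k(M)` with `k = rank M` when the singular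
values are numbered `σ₁ ≥ σ₂ ≥ ⋯` (Mathlib numbers them from zero). -/
noncomputable def sigmaMin (M : Matrix a b ℂ) : ℝ :=
  (Matrix.toEuclideanLin M).singularValues (M.rank - 1)

/-- The Hilbert-Schmidt norm. -/
noncomputable def hsNorm (M : Matrix a a ℂ) : ℝ :=
  Real.sqrt (∑ i, ∑ j, ‖M i j‖ ^ 2)

variable [DecidableEq a]

/-- The trace norm of `M`, as the norm of the functional `X ↦ tr(M X)` with respect to the operator
norm. -/
noncomputable def traceNorm (M : Matrix a a ℂ) : ℝ :=
  sSup {x : ℝ | ∃ X : Matrix a a ℂ,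
    ‖Matrix.toEuclideanCLM (n := a) (𝕜 := ℂ) X‖ ≤ 1 ∧ x = ‖(M * X).trace‖}

/-- The trace distance. -/
noncomputable def traceDist (M M' : Matrix a a ℂ) : ℝ :=
  traceNorm (M - M') / 2

/-- Density matrices, that is states `X ↦ tr(ρ X)` on the full matrix algebra. -/
def IsState (ρ : Matrix a a ℂ) : Prop :=
  ρ.PosSemidef ∧ ρ.trace = 1

end LinearAlgebra

/-! ### The chain: sites `1, …, N`, the element `s : Fin N` standing for the site `s + 1` -/

/-- The set of sites `[i, j] ∩ [1, N]`. -/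
def block (N i j : ℕ) : Finset (Fin N) :=
  Finset.univ.filter fun s => i ≤ (s : ℕ) + 1 ∧ (s : ℕ) + 1 ≤ j

/-- Operators on the sites in `I`, i.e. the algebra `⨂_{s ∈ I} M_d(ℂ)`. -/
abbrev Op (d : ℕ) {N : ℕ} (I : Finset (Fin N)) : Type :=
  Matrix (I → Fin d) (I → Fin d) ℂ

/-- Operators on the whole chain. -/
abbrev ChainOp (d N : ℕ) : Type :=
  Matrix (Fin N → Fin d) (Fin N → Fin d) ℂ

/-- Index set of the matrix units, an orthonormal basis of `Op d I` for the Hilbert-Schmidt inner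
product. -/
abbrev OpIdx (d : ℕ) {N : ℕ} (I : Finset (Fin N)) : Type :=
  (I → Fin d) × (I → Fin d)

section Chain

variable {d N : ℕ}

/-- The matrix unit with index `p`. -/
def unit {I : Finset (Fin N)} (p : OpIdx d I) : Op d I :=
  Matrix.single p.1 p.2 1

/-- The operator `Y ⊗ X` on `I ∪ J` (used for disjoint `I` and `J`). -/
def tens {I J : Finset (Fin N)} (Y : Op d I) (X : Op d J) : Op d (I ∪ J) :=
  of fun s t =>
    Y (fun i => s ⟨i, Finset.mem_union_left J i.2⟩) (fun i => t ⟨i, Finset.mem_union_left J i.2⟩) *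
    X (fun i => s ⟨i, Finset.mem_union_right I i.2⟩) (fun i => t ⟨i, Finset.mem_union_right I i.2⟩)

/-- The product operator `⨂_{s ∈ I} X_s`. -/
def prodOp (X : Fin N → Matrix (Fin d) (Fin d) ℂ) (I : Finset (Fin N)) : Op d I :=
  of fun s t => ∏ i : I, X i (s i) (t i)

/-- The operator on the chain that acts as `X` on `I` and as the identity on all other sites. -/
def embed (I : Finset (Fin N)) (X : Op d I) : ChainOp d N :=
  of fun s t => if ∀ i, i ∉ I → s i = t i then X (fun i => s i) (fun i => t i) else 0

/-- The marginal of `ρ` on `I`: the matrix `ρ_I` with `tr(ρ_I X) = tr(ρ (X ⊗ 1))` for all `X`; its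
entry `(s, t)` is obtained from the matrix unit `X = E_{ts}`. -/
def marginal (ρ : ChainOp d N) (I : Finset (Fin N)) : Op d I :=
  of fun s t => (ρ * embed I (Matrix.single t s 1)).trace

/-- The matrix of `Ω : Op d J → (Op d I)^*`, `Ω[X](Y) = tr(τ (Y ⊗ X))`, in the bases of matrix
units. -/
def omegaMap {I J : Finset (Fin N)} (τ : Op d (I ∪ J)) : Matrix (OpIdx d I) (OpIdx d J) ℂ :=
  of fun p q => (τ * tens (unit p) (unit q)).trace

/-- The matrix of `Ω_A : Op d J → (Op d I)^*`, `Ω_A[X](Y) = tr(τ (Y ⊗ A ⊗ X))`. -/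
def omegaMapAt {I S J : Finset (Fin N)} (τ : Op d ((I ∪ S) ∪ J)) (A : Op d S) :
    Matrix (OpIdx d I) (OpIdx d J) ℂ :=
  of fun p q => (τ * tens (tens (unit p) A) (unit q)).trace

/-- The sites `[j - l + 1, j]` to the left of the cut between the sites `j` and `j + 1`. -/
abbrev leftWin (N l j : ℕ) : Finset (Fin N) := block N (j + 1 - l) j

/-- The sites `[j + 1, j + r]` to the right of the cut between the sites `j` and `j + 1`. -/
abbrev rightWin (N r j : ℕ) : Finset (Fin N) := block N (j + 1) (j + r)

/-- A collection of operators on the local blocks of the chain: `cut j` on the block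
`[j - l + 1, j + r]` and `site k` on the block `[k + 1 - l, k + 1 + r]` around the site `k + 1`
(only `0 ≤ j ≤ N` and `0 ≤ k < N` matter). -/
structure LocalData (d N l r : ℕ) where
  cut : ∀ j : ℕ, Op d (leftWin N l j ∪ rightWin N r j)
  site : ∀ k : ℕ, Op d ((leftWin N l k ∪ block N (k + 1) (k + 1)) ∪ rightWin N r (k + 1))

/-- The marginals of `ρ` on the local blocks. -/
def marginals (l r : ℕ) (ρ : ChainOp d N) : LocalData d N l r where
  cut _ := marginal ρ _
  site _ := marginal ρ _

/-- `E` estimates all the local marginals of `ρ` at precision `ε` in Hilbert-Schmidt distance. -/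
def IsEstimate {l r : ℕ} (ρ : ChainOp d N) (ε : ℝ) (E : LocalData d N l r) : Prop :=
  (∀ j ≤ N, hsNorm (E.cut j - (marginals l r ρ).cut j) ≤ ε) ∧
  ∀ k < N, hsNorm (E.site k - (marginals l r ρ).site k) ≤ ε

/-- `Ω^{[j-l+1,j,j+r]}`. -/
def LocalData.omega {l r : ℕ} (E : LocalData d N l r) (j : ℕ) :
    Matrix (OpIdx d (leftWin N l j)) (OpIdx d (rightWin N r j)) ℂ :=
  omegaMap (E.cut j)

/-- `Ω^{[j-l,j-1,j+r]}_A` with `j = k + 1`, where `A` is an operator on the site `k + 1`. -/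
def LocalData.omegaAt {l r : ℕ} (E : LocalData d N l r) (k : ℕ)
    (A : Op d (block N (k + 1) (k + 1))) :
    Matrix (OpIdx d (leftWin N l k)) (OpIdx d (rightWin N r (k + 1))) ℂ :=
  omegaMapAt (E.site k) A

/-- `(l,r,m)`-finitely correlated states on the chain: for every cut, the rank `m_j` of the map
`Ω^{[1,j,N]}` of the whole chain is that of `Ω^{[j-l+1,j,j+r]}`, and it is at most `m`. -/
def IsFinitelyCorrelated (l r m : ℕ) (ρ : ChainOp d N) : Prop :=
  ∀ j ≤ N,
    (omegaMap (marginal ρ (block N 1 j ∪ block N (j + 1) N))).rank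
      = ((marginals l r ρ).omega j).rank ∧
    ((marginals l r ρ).omega j).rank ≤ m

/-- `σ_{m_j}(Ω^{[j-l+1,j,j+r]})`. -/
noncomputable def sigmaCut (l r : ℕ) (ρ : ChainOp d N) (j : ℕ) : ℝ :=
  sigmaMin ((marginals l r ρ).omega j)

/-! ### Spectral reconstruction -/

/-- A routine that computes singular value decompositions. -/
abbrev SVDRoutine (d N l r : ℕ) : Type :=
  ∀ (j : ℕ) (M : Matrix (OpIdx d (leftWin N l j)) (OpIdx d (rightWin N r j)) ℂ), SVD M

variable {l r : ℕ}

/-- Index set of the singular values `≥ η` of `Ω̂^{[j-l+1,j,j+r]}`. -/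
abbrev Kept (svd : SVDRoutine d N l r) (η : ℝ) (E : LocalData d N l r) (j : ℕ) : Type :=
  {i : Fin (svd j (E.omega j)).size // η ≤ (svd j (E.omega j)).s i}

/-- `Û_j`. -/
def frame (svd : SVDRoutine d N l r) (η : ℝ) (E : LocalData d N l r) (j : ℕ) :
    Matrix (OpIdx d (leftWin N l j)) (Kept svd η E j) ℂ :=
  (svd j (E.omega j)).truncatedU η

/-- `(Û_jᴴ Ω̂^{[j-l+1,j,j+r]})⁺`. -/
noncomputable def framePinv (svd : SVDRoutine d N l r) (η : ℝ) (E : LocalData d N l r) (j : ℕ) :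
    Matrix (OpIdx d (rightWin N r j)) (Kept svd η E j) ℂ :=
  pinv ((frame svd η E j)ᴴ * E.omega j)

/-- `K̂^{(1)}_A = Ω̂_A (Û_1ᴴ Ω̂)⁺`; it has a single row, as no site lies to the left of site `1`. -/
noncomputable def kFirst (svd : SVDRoutine d N l r) (η : ℝ) (E : LocalData d N l r)
    (A : Op d (block N 1 1)) : Matrix (OpIdx d (leftWin N l 0)) (Kept svd η E 1) ℂ :=
  E.omegaAt 0 A * framePinv svd η E 1

/-- `K̂^{(j)}_A = Û_{j-1}ᴴ Ω̂_A (Û_jᴴ Ω̂)⁺` with `j = k + 2`. -/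
noncomputable def kMid (svd : SVDRoutine d N l r) (η : ℝ) (E : LocalData d N l r) (k : ℕ)
    (A : Op d (block N (k + 2) (k + 2))) :
    Matrix (Kept svd η E (k + 1)) (Kept svd η E (k + 2)) ℂ :=
  (frame svd η E (k + 1))ᴴ * E.omegaAt (k + 1) A * framePinv svd η E (k + 2)

/-- `K̂^{(N)}_A = Û_{N-1}ᴴ Ω̂_A`, where `N = k + 2`; it has a single column. -/
noncomputable def kLast (svd : SVDRoutine d N l r) (η : ℝ) (E : LocalData d N l r) (k : ℕ)
    (A : Op d (block N (k + 2) (k + 2))) :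
    Matrix (Kept svd η E (k + 1)) (OpIdx d (rightWin N r (k + 2))) ℂ :=
  (frame svd η E (k + 1))ᴴ * E.omegaAt (k + 1) A

/-- `K̂^{(1)}_{X_1} ⋯ K̂^{(k+1)}_{X_{k+1}}`. -/
noncomputable def kProd (svd : SVDRoutine d N l r) (η : ℝ) (E : LocalData d N l r)
    (X : Fin N → Matrix (Fin d) (Fin d) ℂ) :
    (k : ℕ) → Matrix (OpIdx d (leftWin N l 0)) (Kept svd η E (k + 1)) ℂ
  | 0 => kFirst svd η E (prodOp X (block N 1 1))
  | k + 1 => kProd svd η E X k * kMid svd η E k (prodOp X (block N (k + 2) (k + 2)))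

/-- `ω̂(X_1 ⊗ ⋯ ⊗ X_N) = K̂^{(1)}_{X_1} ⋯ K̂^{(N)}_{X_N}` for `N ≥ 2`. The product is a matrix with one
row and one column, and the double sum reads off its entry. -/
noncomputable def reconValue (svd : SVDRoutine d N l r) (η : ℝ) (E : LocalData d N l r)
    (X : Fin N → Matrix (Fin d) (Fin d) ℂ) : ℂ :=
  ∑ p, ∑ q, (kProd svd η E X (N - 2) *
    kLast svd η E (N - 2) (prodOp X (block N (N - 2 + 2) (N - 2 + 2)))) p q

/-- The spectral reconstruction: the matrix `ρ̂` of the linear functional `ω̂`, that is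
`tr(ρ̂ X) = ω̂(X)`; its entry `(s, t)` is `ω̂(E_{ts})`, where `E_{ts} = ⨂_i E_{t_i s_i}`. -/
noncomputable def recon (svd : SVDRoutine d N l r) (η : ℝ) (E : LocalData d N l r) : ChainOp d N :=
  of fun s t => reconValue svd η E fun i => Matrix.single (t i) (s i) 1

end Chain

/-! ### Local measurements on `n` copies -/

/-- A (possibly collective) measurement with finitely many outcomes on `n` copies of the chain that
touches, on each copy, only a block of at most `l + r + 1` consecutive sites: `start c` is the first
site of the block used on the copy `c`, and `effect` is a positive operator valued measure. -/
structure LocalMeasurement (d N l r n : ℕ) where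
  start : Fin n → ℕ
  outcomes : ℕ
  effect : Fin outcomes →
    Matrix (∀ c, block N (start c) (start c + l + r) → Fin d)
      (∀ c, block N (start c) (start c + l + r) → Fin d) ℂ
  effect_pos : ∀ x, (effect x).PosSemidef
  effect_sum : ∑ x, effect x = 1

/-- The tensor product of the marginals, on the measured blocks, of `n` copies of `ρ`. -/
def LocalMeasurement.copies {d N l r n : ℕ} (T : LocalMeasurement d N l r n) (ρ : ChainOp d N) :
    Matrix (∀ c, block N (T.start c) (T.start c + l + r) → Fin d)
      (∀ c, block N (T.start c) (T.start c + l + r) → Fin d) ℂ :=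
  of fun s t => ∏ c, marginal ρ (block N (T.start c) (T.start c + l + r)) (s c) (t c)

open Classical in
/-- The probability that the outcome of the measurement on `n` copies of `ρ` satisfies `P`. -/
noncomputable def LocalMeasurement.prob {d N l r n : ℕ} (T : LocalMeasurement d N l r n)
    (ρ : ChainOp d N) (P : Fin T.outcomes → Prop) : ℝ :=
  ∑ x ∈ Finset.univ.filter P, (T.copies ρ * T.effect x).trace.re

end FinChain

/-! The reconstructed functional is the true state evaluated on a slightly perturbed operator: there
is a linear map `Ψ` on the chain algebra with `ω̂(X) = ω(Ψ X)`, a composition of `N` factors `id +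
Φ`, one per site, with `‖Φ‖ ≤ Δ` for each. Hence `‖ω̂ - ω‖₁ ≤ (1 + Δ)^N - 1`, and no error
propagation through products of the matrices `K̂`, whose norms are not controlled, is needed.

At a cut, the rows of `Û_jᴴ` are operators `z_b` on the left, and the columns of a right inverse `R`
of `Û_jᴴ Ω` are operators `x_b` on the right, with `ω(z_a x_b) = δ_ab`. There are exactly `m_j` of
each, the rank of the correlation map of the whole chain. So an operator on the right that is
orthogonal to every `z_b` is orthogonal to everything on the left (`expect_mul_eq_zero`), and `V`
may be replaced by `∑ ω(z_b V) x_b` in expectations. Consequently the true matrices `K_A = Û_{j-1}ᴴ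
Ω_A R` propagate the coefficients `ω(z_b V)` exactly (`CutBound.expect_transfer`).

To propagate with `K̂` instead, the operator `A V` is corrected by `∑_a (∑_b (K̂ - K)_ab ω(z_b V))
x_a` (`exists_step`). This correction is a superoperator built from slice maps `id ⊗ φ`, which have
the norm of `φ` whatever the length of the rest of the chain (`exists_slice`); only `m²` pairs `(a,
b)` and the factor `√d` of one site enter the bound (`exists_correction`). Applying the corrections
from the last site to the first turns `X_1 ⋯ X_N` into an operator whose expectation is the matrix
product `ω̂(X)` (`hybrid_mid`, `exists_hybrid`).

The analytic input is singular value perturbation (`SVD.truncated_properties`): the threshold keeps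
exactly `m_j` singular vectors, and both the estimated pseudo-inverse and `R` have norm at most
`2/σ_j`. This gives `‖K̂ - K‖ ≤ 7ε/s²` in the Hilbert-Schmidt sense and `Δ = 14 m √d ε / s³`, with
`s` the smallest `σ_j` for `1 ≤ j ≤ N`, so that `N Δ` is `7/10` of the target error. -/

namespace FinChain

open Matrix
open scoped ComplexOrder Matrix.Norms.L2Operator

/-! ### Frobenius norm -/

section Frobenius

variable {a b : Type} [Fintype a] [Fintype b]

/-- The square of the Frobenius norm. -/
noncomputable def frobSq (M : Matrix a b ℂ) : ℝ := ∑ i, ∑ j, ‖M i j‖ ^ 2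

theorem frobSq_nonneg (M : Matrix a b ℂ) : 0 ≤ frobSq M :=
  Finset.sum_nonneg fun _ _ => Finset.sum_nonneg fun _ _ => by positivity

theorem frobSq_conjTranspose (M : Matrix a b ℂ) : frobSq Mᴴ = frobSq M := by
  unfold frobSq
  rw [Finset.sum_comm]
  simp

theorem frobSq_add_le (M M' : Matrix a b ℂ) : frobSq (M + M') ≤ 2 * (frobSq M + frobSq M') := by
  unfold frobSq
  simp only [mul_add, Finset.mul_sum, ← Finset.sum_add_distrib]
  refine Finset.sum_le_sum fun i _ => Finset.sum_le_sum fun j _ => ?_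
  have := norm_add_le (M i j) (M' i j)
  rw [Matrix.add_apply]
  nlinarith [norm_nonneg (M i j + M' i j), sq_nonneg (‖M i j‖ - ‖M' i j‖)]

theorem norm_toLp_sq (v : a → ℂ) : ‖WithLp.toLp 2 v‖ ^ 2 = ∑ i, ‖v i‖ ^ 2 := by
  rw [EuclideanSpace.norm_sq_eq]

theorem norm_toLp_sq_eq_dotProduct (v : a → ℂ) :
    ((‖WithLp.toLp 2 v‖ ^ 2 : ℝ) : ℂ) = star v ⬝ᵥ v := by
  rw [norm_toLp_sq, dotProduct]
  push_cast
  exact Finset.sum_congr rfl fun i _ => by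
    rw [Pi.star_apply, RCLike.star_def, Complex.conj_mul']

end Frobenius

/-! ### Operator norm and its comparison with the Frobenius norm -/

section OperatorNorm

variable {a b c : Type} [Fintype a] [Fintype b] [Fintype c] [DecidableEq b]

theorem norm_toLp_mulVec_le (M : Matrix a b ℂ) (v : b → ℂ) :
    ‖WithLp.toLp 2 (M *ᵥ v)‖ ≤ ‖M‖ * ‖WithLp.toLp 2 v‖ :=
  l2_opNorm_mulVec M (WithLp.toLp 2 v)

theorem opNorm_le_of_mulVec_le (M : Matrix a b ℂ) {C : ℝ} (hC : 0 ≤ C)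
    (h : ∀ v : b → ℂ, ‖WithLp.toLp 2 (M *ᵥ v)‖ ≤ C * ‖WithLp.toLp 2 v‖) : ‖M‖ ≤ C := by
  rw [l2_opNorm_def]
  exact ContinuousLinearMap.opNorm_le_bound _ hC fun x => h x.ofLp

theorem norm_toLp_mulVec_of_isometry {M : Matrix a b ℂ} (hM : Mᴴ * M = 1) (v : b → ℂ) :
    ‖WithLp.toLp 2 (M *ᵥ v)‖ = ‖WithLp.toLp 2 v‖ := by
  rw [← sq_eq_sq₀ (norm_nonneg _) (norm_nonneg _)]
  apply Complex.ofReal_injective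
  rw [norm_toLp_sq_eq_dotProduct, norm_toLp_sq_eq_dotProduct, star_mulVec, ← dotProduct_mulVec,
    mulVec_mulVec, hM, one_mulVec]

theorem opNorm_le_one_of_isometry {M : Matrix a b ℂ} (hM : Mᴴ * M = 1) : ‖M‖ ≤ 1 :=
  opNorm_le_of_mulVec_le M zero_le_one fun v => by rw [norm_toLp_mulVec_of_isometry hM, one_mul]

theorem frobSq_mul_le_left (M : Matrix a b ℂ) (M' : Matrix b c ℂ) :
    frobSq (M * M') ≤ ‖M‖ ^ 2 * frobSq M' := by
  unfold frobSq
  rw [Finset.sum_comm, Finset.sum_comm (s := (Finset.univ : Finset b)), Finset.mul_sum]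
  refine Finset.sum_le_sum fun j _ => ?_
  have h := norm_toLp_mulVec_le M (fun i => M' i j)
  have h2 := pow_le_pow_left₀ (norm_nonneg _) h 2
  rw [mul_pow, norm_toLp_sq, norm_toLp_sq] at h2
  exact h2

theorem frobSq_mul_le_right [DecidableEq c] (M : Matrix a b ℂ) (M' : Matrix b c ℂ) :
    frobSq (M * M') ≤ frobSq M * ‖M'‖ ^ 2 := by
  rw [← frobSq_conjTranspose, conjTranspose_mul, ← frobSq_conjTranspose M,
    ← l2_opNorm_conjTranspose M', mul_comm]
  exact frobSq_mul_le_left _ _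

theorem opNorm_le_sqrt_frobSq (M : Matrix a b ℂ) : ‖M‖ ≤ √(frobSq M) := by
  refine opNorm_le_of_mulVec_le M (Real.sqrt_nonneg _) fun v => ?_
  refine le_of_sq_le_sq ?_ (by positivity)
  rw [mul_pow, Real.sq_sqrt (frobSq_nonneg M), norm_toLp_sq, norm_toLp_sq, frobSq, Finset.sum_mul]
  refine Finset.sum_le_sum fun i _ => ?_
  have h1 : ‖(M *ᵥ v) i‖ ≤ ∑ j, ‖M i j‖ * ‖v j‖ := by
    rw [mulVec, dotProduct]
    exact (norm_sum_le _ _).trans_eq (by simp)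
  exact (pow_le_pow_left₀ (norm_nonneg _) h1 2).trans (Finset.sum_mul_sq_le_sq_mul_sq _ _ _)

theorem sum_sq_col_le (M : Matrix a b ℂ) (j : b) : ∑ i, ‖M i j‖ ^ 2 ≤ ‖M‖ ^ 2 := by
  have h := norm_toLp_mulVec_le M (Pi.single j 1)
  have h2 := pow_le_pow_left₀ (norm_nonneg _) h 2
  have e : ‖WithLp.toLp 2 (Pi.single j 1 : b → ℂ)‖ = 1 := by simp
  rw [mul_pow, norm_toLp_sq, e, one_pow, mul_one] at h2
  simpa using h2

theorem frobSq_le_card_mul (M : Matrix a b ℂ) : frobSq M ≤ Fintype.card b * ‖M‖ ^ 2 := by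
  unfold frobSq
  rw [Finset.sum_comm]
  calc ∑ j, ∑ i, ‖M i j‖ ^ 2 ≤ ∑ _j : b, ‖M‖ ^ 2 := Finset.sum_le_sum fun j _ => sum_sq_col_le M j
    _ = _ := by simp

/-- The triangle inequality gives `‖A v‖ ≥ (1 - t) ‖v‖`, so the square matrix `A` is injective,
hence invertible, and the same lower bound controls its inverse. -/
theorem exists_inverse_of_norm_one_sub_le [DecidableEq a] {A : Matrix a a ℂ} {t : ℝ} (ht : t < 1)
    (hA : ‖1 - A‖ ≤ t) : ∃ B : Matrix a a ℂ, A * B = 1 ∧ ‖B‖ ≤ (1 - t)⁻¹ := by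
  have hlow : ∀ v : a → ℂ, (1 - t) * ‖WithLp.toLp 2 v‖ ≤ ‖WithLp.toLp 2 (A *ᵥ v)‖ := by
    intro v
    have h1 := norm_toLp_mulVec_le (1 - A) v
    have h2 : WithLp.toLp 2 v = WithLp.toLp 2 ((1 - A) *ᵥ v) + WithLp.toLp 2 (A *ᵥ v) := by
      rw [← WithLp.toLp_add, ← add_mulVec, sub_add_cancel, one_mulVec]
    have h3 := norm_add_le (WithLp.toLp 2 ((1 - A) *ᵥ v)) (WithLp.toLp 2 (A *ᵥ v))
    rw [← h2] at h3
    nlinarith [norm_nonneg (WithLp.toLp 2 v)]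
  have hinj : Function.Injective A.mulVec := by
    intro v w hvw
    have h := hlow (v - w)
    rw [mulVec_sub, hvw, sub_self, WithLp.toLp_zero, norm_zero] at h
    have h0 : ‖WithLp.toLp 2 (v - w)‖ = 0 := by
      nlinarith [norm_nonneg (WithLp.toLp 2 (v - w))]
    exact sub_eq_zero.1 ((WithLp.toLp_eq_zero 2).1 (norm_eq_zero.1 h0))
  have hu : IsUnit A := mulVec_injective_iff_isUnit.1 hinj
  have hAA : A * A⁻¹ = 1 := mul_nonsing_inv A ((isUnit_iff_isUnit_det A).1 hu)
  refine ⟨A⁻¹, hAA, opNorm_le_of_mulVec_le _ (inv_nonneg.2 (by linarith)) fun v => ?_⟩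
  have h := hlow (A⁻¹ *ᵥ v)
  rw [mulVec_mulVec, hAA, one_mulVec] at h
  rw [inv_mul_eq_div, le_div_iff₀ (by linarith)]
  linarith

end OperatorNorm

/-! ### The smallest nonzero singular value -/

section SingularValues

variable {a b : Type} [Fintype a] [Fintype b] [DecidableEq b]

theorem rank_eq_finrank_range_toEuclideanLin (M : Matrix a b ℂ) :
    M.rank = Module.finrank ℂ (Matrix.toEuclideanLin M).range := by
  classical
  rw [show Matrix.toEuclideanLin M = _ from congrArg (fun F => F M) (toLpLin_eq_toLin 2 2)]
  exact M.rank_eq_finrank_range_toLin (PiLp.basisFun 2 ℂ a) (PiLp.basisFun 2 ℂ b)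

theorem sigmaMin_pos {M : Matrix a b ℂ} (hM : M.rank ≠ 0) : 0 < sigmaMin M := by
  rw [sigmaMin, LinearMap.singularValues_pos_iff_lt_finrank_range,
    ← rank_eq_finrank_range_toEuclideanLin]
  omega

/-- The columns of `W` are the first `rank M` vectors of an orthonormal eigenbasis of `Mᴴ M`,
ordered by decreasing singular value. On their span every singular value is at least `sigmaMin M`.
-/
theorem exists_isometry_sigmaMin_le (M : Matrix a b ℂ) :
    ∃ W : Matrix b (Fin M.rank) ℂ, Wᴴ * W = 1 ∧
      ∀ v, sigmaMin M * ‖WithLp.toLp 2 v‖ ≤ ‖WithLp.toLp 2 ((M * W) *ᵥ v)‖ := by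
  classical
  set T := Matrix.toEuclideanLin M with hT
  have hn : Module.finrank ℂ (EuclideanSpace ℂ b) = Fintype.card b := by simp
  have hS := T.isSymmetric_adjoint_comp_self
  set e := hS.eigenvectorBasis hn with he
  have hr : M.rank ≤ Fintype.card b := M.rank_le_card_width
  let f : Fin M.rank → Fin (Fintype.card b) := Fin.castLE hr
  have hf : Function.Injective f := Fin.castLE_injective hr
  let W : Matrix b (Fin M.rank) ℂ := of fun x i => (e (f i)) x
  have hadj : LinearMap.adjoint T = Matrix.toEuclideanLin Mᴴ :=
    (Matrix.toEuclideanLin_conjTranspose_eq_adjoint M).symm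
  have hWW : Wᴴ * W = 1 := by
    ext i j
    have h2 : inner ℂ (e (f i)) (e (f j)) = if f i = f j then (1 : ℂ) else 0 :=
      orthonormal_iff_ite.1 e.orthonormal _ _
    rw [Matrix.mul_apply, Matrix.one_apply]
    rw [PiLp.inner_apply] at h2
    simp only [hf.eq_iff] at h2
    rw [← h2]
    refine Finset.sum_congr rfl fun x _ => ?_
    simp [W, mul_comm]
  have hMW : (M * W)ᴴ * (M * W) = diagonal fun i : Fin M.rank =>
      ((T.singularValues i ^ 2 : ℝ) : ℂ) := by
    have h1 : Mᴴ * M * W = W * diagonal fun i : Fin M.rank =>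
        ((T.singularValues i ^ 2 : ℝ) : ℂ) := by
      ext x i
      have h2 := hS.apply_eigenvectorBasis hn (f i)
      rw [← T.sq_singularValues_fin hn, LinearMap.comp_apply, ← he] at h2
      replace h2 := (congrArg (fun F => F (T (e (f i)))) hadj).symm.trans h2
      have h3 := congrArg (fun v : EuclideanSpace ℂ b => v x) h2
      rw [mul_diagonal]
      have h4 : (Mᴴ * M * W) x i = (Mᴴ *ᵥ (M *ᵥ (e (f i)).ofLp)) x := by
        rw [Matrix.mul_assoc, Matrix.mul_apply, mulVec, dotProduct]
        rfl
      rw [h4]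
      refine Eq.trans h3 ?_
      rw [mul_comm]
      simp [W, f, he]
    rw [conjTranspose_mul, Matrix.mul_assoc, ← Matrix.mul_assoc Mᴴ, h1, ← Matrix.mul_assoc, hWW,
      Matrix.one_mul]
  refine ⟨W, hWW, fun v => le_of_sq_le_sq ?_ (norm_nonneg _)⟩
  rw [mul_pow]
  have h5 : ‖WithLp.toLp 2 ((M * W) *ᵥ v)‖ ^ 2
      = ∑ i : Fin M.rank, T.singularValues i ^ 2 * ‖v i‖ ^ 2 := by
    apply Complex.ofReal_injective
    rw [norm_toLp_sq_eq_dotProduct, star_mulVec, ← dotProduct_mulVec, mulVec_mulVec, hMW,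
      dotProduct]
    push_cast
    refine Finset.sum_congr rfl fun i _ => ?_
    rw [mulVec_diagonal, Pi.star_apply, RCLike.star_def, ← Complex.conj_mul']
    ring
  rw [h5, norm_toLp_sq, Finset.mul_sum]
  refine Finset.sum_le_sum fun i _ => mul_le_mul_of_nonneg_right ?_ (by positivity)
  refine pow_le_pow_left₀ (T.singularValues_nonneg _) (T.singularValues_antitone ?_) 2
  have := i.2
  omega

theorem sigmaMin_le_opNorm {M : Matrix a b ℂ} (hM : M.rank ≠ 0) : sigmaMin M ≤ ‖M‖ := by
  obtain ⟨W, hW, h⟩ := exists_isometry_sigmaMin_le M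
  let i : Fin M.rank := ⟨0, Nat.pos_of_ne_zero hM⟩
  have h1 := h (Pi.single i 1)
  have e : ‖WithLp.toLp 2 (Pi.single i 1 : Fin M.rank → ℂ)‖ = 1 := by
    simp
  rw [← mulVec_mulVec, e, mul_one] at h1
  refine h1.trans ((norm_toLp_mulVec_le _ _).trans_eq ?_)
  rw [norm_toLp_mulVec_of_isometry hW, e, mul_one]

end SingularValues

/-! ### Perturbation of the truncated singular value decomposition -/

section TruncatedSVD

variable {a b : Type} [Fintype a] [Fintype b]

theorem SVD.truncatedU_isometry {M : Matrix a b ℂ} (D : SVD M) (η : ℝ) :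
    (D.truncatedU η)ᴴ * D.truncatedU η = 1 := by
  have h : (D.truncatedU η)ᴴ * D.truncatedU η
      = (D.Uᴴ * D.U).submatrix Subtype.val Subtype.val := rfl
  rw [h, D.U_orthonormal, submatrix_one _ Subtype.val_injective]

/-- The right singular vectors belonging to the columns of `truncatedU`. -/
def SVD.truncatedV {M : Matrix a b ℂ} (D : SVD M) (η : ℝ) :
    Matrix b {i : Fin D.size // η ≤ D.s i} ℂ :=
  D.V.submatrix id Subtype.val

theorem SVD.truncatedV_isometry {M : Matrix a b ℂ} (D : SVD M) (η : ℝ) :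
    (D.truncatedV η)ᴴ * D.truncatedV η = 1 := by
  have h : (D.truncatedV η)ᴴ * D.truncatedV η
      = (D.Vᴴ * D.V).submatrix Subtype.val Subtype.val := rfl
  rw [h, D.V_orthonormal, submatrix_one _ Subtype.val_injective]

theorem SVD.truncatedU_conjTranspose_mul {M : Matrix a b ℂ} (D : SVD M) (η : ℝ) :
    (D.truncatedU η)ᴴ * M
      = diagonal (fun i : {i : Fin D.size // η ≤ D.s i} => (D.s i : ℂ)) * (D.truncatedV η)ᴴ := by
  have h : (D.truncatedU η)ᴴ * M = (D.Uᴴ * M).submatrix Subtype.val id := by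
    ext i j; rfl
  have h2 : D.Uᴴ * M = diagonal (fun i => (D.s i : ℂ)) * D.Vᴴ := by
    refine (congrArg (D.Uᴴ * ·) D.decomp).trans ?_
    rw [← Matrix.mul_assoc, ← Matrix.mul_assoc, D.U_orthonormal, Matrix.one_mul]
  rw [h, h2]
  ext i j
  simp [diagonal_mul, truncatedV]

variable [DecidableEq b]

theorem exists_ne_zero_mulVec_eq_zero {k n : Type} [Fintype k] [Fintype n] [DecidableEq n]
    (A : Matrix k n ℂ) (h : Fintype.card k < Fintype.card n) : ∃ v, v ≠ 0 ∧ A *ᵥ v = 0 := by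
  have := LinearMap.ker_ne_bot_of_finrank_lt (f := A.mulVecLin) (by simpa using h)
  obtain ⟨v, hv, hv0⟩ := (Submodule.ne_bot_iff _).1 this
  exact ⟨v, hv0, hv⟩

variable {M M' : Matrix a b ℂ} {ε η : ℝ}

/-- Compressed to the kept singular vectors, `M'` is diagonal with entries at least `η`. The same
compression of `M` differs from it by at most `ε < η`, so it is still injective, and its size cannot
exceed the rank of `M`. -/
theorem SVD.card_kept_le_rank (D : SVD M') (hE : ‖M' - M‖ ≤ ε) (hεη : ε < η) :
    Fintype.card {i : Fin D.size // η ≤ D.s i} ≤ M.rank := by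
  classical
  set A := (D.truncatedU η)ᴴ * M * D.truncatedV η with hA
  have hdiag : (D.truncatedU η)ᴴ * M' * D.truncatedV η
      = diagonal (fun i : {i : Fin D.size // η ≤ D.s i} => (D.s i : ℂ)) := by
    rw [D.truncatedU_conjTranspose_mul, Matrix.mul_assoc, D.truncatedV_isometry, Matrix.mul_one]
  have hη : 0 ≤ η := (norm_nonneg _).trans (hE.trans hεη.le)
  have hdiff : ‖diagonal (fun i : {i : Fin D.size // η ≤ D.s i} => (D.s i : ℂ)) - A‖ ≤ ε := by
    rw [← hdiag, hA, ← Matrix.sub_mul, ← Matrix.mul_sub]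
    refine (l2_opNorm_mul _ _).trans ?_
    have h1 := l2_opNorm_mul (D.truncatedU η)ᴴ (M' - M)
    rw [l2_opNorm_conjTranspose] at h1
    have h2 := opNorm_le_one_of_isometry (D.truncatedU_isometry η)
    have h3 := opNorm_le_one_of_isometry (D.truncatedV_isometry η)
    have h4 : ‖(D.truncatedU η)ᴴ * (M' - M)‖ ≤ ε := by nlinarith [norm_nonneg (M' - M)]
    nlinarith [norm_nonneg ((D.truncatedU η)ᴴ * (M' - M))]
  have hinj : Function.Injective A.mulVec := by
    have key : ∀ v, A *ᵥ v = 0 → v = 0 := by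
      intro v hv
      have h1 := norm_toLp_mulVec_le
        (diagonal (fun i : {i : Fin D.size // η ≤ D.s i} => (D.s i : ℂ)) - A) v
      rw [sub_mulVec, hv, sub_zero] at h1
      have h2 : η * ‖WithLp.toLp 2 v‖ ≤ ‖WithLp.toLp 2
          (diagonal (fun i : {i : Fin D.size // η ≤ D.s i} => (D.s i : ℂ)) *ᵥ v)‖ := by
        refine le_of_sq_le_sq ?_ (norm_nonneg _)
        rw [mul_pow, norm_toLp_sq, norm_toLp_sq, Finset.mul_sum]
        refine Finset.sum_le_sum fun i _ => ?_
        rw [mulVec_diagonal, norm_mul, mul_pow, Complex.norm_real, Real.norm_eq_abs, sq_abs]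
        exact mul_le_mul_of_nonneg_right (pow_le_pow_left₀ hη i.2 2) (by positivity)
      have h3 : ‖WithLp.toLp 2 v‖ = 0 := by nlinarith [norm_nonneg (WithLp.toLp 2 v)]
      exact (WithLp.toLp_eq_zero 2).1 (norm_eq_zero.1 h3)
    intro v w hvw
    refine sub_eq_zero.1 (key _ ?_)
    rw [mulVec_sub, hvw, sub_self]
  have hrank : A.rank = Fintype.card {i : Fin D.size // η ≤ D.s i} :=
    rank_of_isUnit A (mulVec_injective_iff_isUnit.1 hinj)
  rw [← hrank]
  exact (rank_mul_le_left _ _).trans (rank_mul_le_right _ _)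

/-- A Weyl-type inequality by dimension count. If `M'` had fewer than `rank M` singular values above
`sigmaMin M - ε`, some nonzero vector in the range of `W` would be orthogonal to all their right
singular vectors. `M'` would then stretch it by less than `sigmaMin M - ε`, although it is `ε`-close
to `M`, which stretches it by at least `sigmaMin M`. -/
theorem SVD.rank_le_card_large (D : SVD M') (hE : ‖M' - M‖ ≤ ε) (hσ : ε < sigmaMin M) :
    M.rank ≤ Fintype.card {i : Fin D.size // sigmaMin M - ε ≤ D.s i} := by
  classical
  by_contra! hlt
  obtain ⟨W, hW, hWσ⟩ := exists_isometry_sigmaMin_le M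
  obtain ⟨c, hc0, hc⟩ := exists_ne_zero_mulVec_eq_zero
    ((D.truncatedV (sigmaMin M - ε))ᴴ * W) (by simpa using hlt)
  have hcpos : 0 < ‖WithLp.toLp 2 c‖ :=
    norm_pos_iff.2 fun h => hc0 ((WithLp.toLp_eq_zero 2).1 h)
  have hlow : (sigmaMin M - ε) * ‖WithLp.toLp 2 c‖ ≤ ‖WithLp.toLp 2 (M' *ᵥ (W *ᵥ c))‖ := by
    have h1 := hWσ c
    have h2 := norm_toLp_mulVec_le (M' - M) (W *ᵥ c)
    rw [norm_toLp_mulVec_of_isometry hW] at h2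
    have h3 : WithLp.toLp 2 ((M * W) *ᵥ c)
        = WithLp.toLp 2 (M' *ᵥ (W *ᵥ c)) - WithLp.toLp 2 ((M' - M) *ᵥ (W *ᵥ c)) := by
      rw [← WithLp.toLp_sub, sub_mulVec, sub_sub_cancel, mulVec_mulVec]
    rw [h3] at h1
    have h4 := norm_sub_le (WithLp.toLp 2 (M' *ᵥ (W *ᵥ c)))
      (WithLp.toLp 2 ((M' - M) *ᵥ (W *ᵥ c)))
    nlinarith
  set y := D.Vᴴ *ᵥ (W *ᵥ c) with hy
  have hM'y : M' *ᵥ (W *ᵥ c) = D.U *ᵥ (diagonal (fun i => (D.s i : ℂ)) *ᵥ y) := by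
    conv_lhs => rw [D.decomp]
    rw [hy, ← mulVec_mulVec, ← mulVec_mulVec]
  rw [hM'y, norm_toLp_mulVec_of_isometry D.U_orthonormal] at hlow
  have hylow : ‖WithLp.toLp 2 y‖ ≤ ‖WithLp.toLp 2 c‖ := by
    have h1 := norm_toLp_mulVec_le D.Vᴴ (W *ᵥ c)
    rw [norm_toLp_mulVec_of_isometry hW, l2_opNorm_conjTranspose] at h1
    have h2 := opNorm_le_one_of_isometry D.V_orthonormal
    exact h1.trans (mul_le_of_le_one_left (norm_nonneg _) h2)
  have hyK : ∀ i, sigmaMin M - ε ≤ D.s i → y i = 0 := by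
    intro i hi
    have h1 := congrFun hc ⟨i, hi⟩
    rw [← mulVec_mulVec] at h1
    exact h1
  have hτ : 0 < sigmaMin M - ε := by linarith
  have hlow2 := pow_le_pow_left₀ (by positivity) hlow 2
  rw [mul_pow, norm_toLp_sq (diagonal (fun i => (D.s i : ℂ)) *ᵥ y)] at hlow2
  have hterm : ∀ i, ‖(diagonal (fun i => (D.s i : ℂ)) *ᵥ y) i‖ ^ 2 = D.s i ^ 2 * ‖y i‖ ^ 2 := by
    intro i
    rw [mulVec_diagonal, norm_mul, mul_pow, Complex.norm_real, Real.norm_eq_abs, sq_abs]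
  simp only [hterm] at hlow2
  have hle : ∀ i, D.s i ^ 2 * ‖y i‖ ^ 2 ≤ (sigmaMin M - ε) ^ 2 * ‖y i‖ ^ 2 := by
    intro i
    by_cases hi : sigmaMin M - ε ≤ D.s i
    · simp [hyK i hi]
    · exact mul_le_mul_of_nonneg_right
        (pow_le_pow_left₀ (D.s_nonneg i) (not_le.1 hi).le 2) (by positivity)
  -- Strictness: either `y = 0` and `M'` kills a vector it must stretch, or some nonzero coordinate
  -- of `y` sits at a singular value strictly below `sigmaMin M - ε`.
  by_cases hy0 : ∀ i, y i = 0
  · have : 0 < (sigmaMin M - ε) ^ 2 * ‖WithLp.toLp 2 c‖ ^ 2 := by positivity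
    simp [hy0] at hlow2
    linarith
  · push Not at hy0
    obtain ⟨i, hi⟩ := hy0
    have hi' : D.s i < sigmaMin M - ε := not_le.1 fun h => hi (hyK i h)
    have hlt2 : ∑ i, D.s i ^ 2 * ‖y i‖ ^ 2 < ∑ i, (sigmaMin M - ε) ^ 2 * ‖y i‖ ^ 2 :=
      Finset.sum_lt_sum (fun i _ => hle i) ⟨i, Finset.mem_univ _,
        mul_lt_mul_of_pos_right (pow_lt_pow_left₀ hi' (D.s_nonneg i) two_ne_zero)
          (by have := norm_pos_iff.2 hi; positivity)⟩
    rw [← Finset.mul_sum, ← norm_toLp_sq] at hlt2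
    have h5 := pow_le_pow_left₀ (norm_nonneg _) hylow 2
    nlinarith [mul_le_mul_of_nonneg_left h5 (sq_nonneg (sigmaMin M - ε))]

/-- The singular values above `sigmaMin M - ε` are among those above `η`. The two counting bounds
squeeze both sets to size `rank M`, so they coincide: no singular value lies in `[η, sigmaMin M -
ε)`. -/
theorem SVD.kept_iff_large (D : SVD M') (hE : ‖M' - M‖ ≤ ε) (hεη : ε < η)
    (hησ : η ≤ sigmaMin M - ε) :
    Fintype.card {i : Fin D.size // η ≤ D.s i} = M.rank ∧
      ∀ i, η ≤ D.s i → sigmaMin M - ε ≤ D.s i := by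
  classical
  have h1 := D.card_kept_le_rank hE hεη
  have h2 := D.rank_le_card_large hE (by linarith [(norm_nonneg _).trans hE])
  rw [Fintype.card_subtype] at h1 h2 ⊢
  have hsub : Finset.univ.filter (fun i => sigmaMin M - ε ≤ D.s i)
      ⊆ Finset.univ.filter (fun i => η ≤ D.s i) := by
    intro i hi
    simp only [Finset.mem_filter, Finset.mem_univ, true_and] at hi ⊢
    exact hησ.trans hi
  have heq := Finset.eq_of_subset_of_card_le hsub (h1.trans h2)
  refine ⟨le_antisymm h1 (heq ▸ h2), fun i hi => ?_⟩
  have : i ∈ Finset.univ.filter (fun i => η ≤ D.s i) := by simpa using hi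
  rw [← heq] at this
  simpa using this

/-- For a right inverse `Q`, the projections `Q B` and `P B` absorb each other; both being
Hermitian, they are equal. -/
theorem IsMoorePenrose.eq_of_mul_eq_one {k n : Type} [Fintype k] [DecidableEq k] [Fintype n]
    [DecidableEq n] {B : Matrix k n ℂ} {P Q : Matrix n k ℂ} (hP : IsMoorePenrose B P)
    (hQ : B * Q = 1) (hQB : (Q * B)ᴴ = Q * B) : P = Q := by
  have hBP : B * P = 1 := by
    have h := congrArg (· * Q) hP.mul_mul_self
    simp only [Matrix.mul_assoc, hQ, Matrix.mul_one] at h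
    exact h
  have h1 : P * B * (Q * B) = P * B := by
    rw [Matrix.mul_assoc, ← Matrix.mul_assoc B, hQ, Matrix.one_mul]
  have h2 : Q * B * (P * B) = Q * B := by
    rw [Matrix.mul_assoc, ← Matrix.mul_assoc B, hBP, Matrix.one_mul]
  have h3 := congrArg conjTranspose h1
  rw [conjTranspose_mul, hQB, hP.right_hermitian, h2] at h3
  calc P = P * B * Q := by rw [Matrix.mul_assoc, hQ, Matrix.mul_one]
    _ = Q := by rw [← h3, Matrix.mul_assoc, hQ, Matrix.mul_one]

/-- Properties of the truncated left singular vectors of an approximation `M'` of `M`. -/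
theorem SVD.truncated_properties [DecidableEq a] (D : SVD M') (hε : 0 < ε) (hE : ‖M' - M‖ ≤ ε)
    (hεη : 2 * ε ≤ η) (hησ : η ≤ sigmaMin M / 2) :
    Fintype.card {i : Fin D.size // η ≤ D.s i} = M.rank ∧
    (D.truncatedU η)ᴴ * M' * pinv ((D.truncatedU η)ᴴ * M') = 1 ∧
    ‖pinv ((D.truncatedU η)ᴴ * M')‖ ≤ 2 / sigmaMin M ∧
    ∃ R : Matrix b {i : Fin D.size // η ≤ D.s i} ℂ, (D.truncatedU η)ᴴ * M * R = 1 ∧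
      ‖R‖ ≤ 2 / sigmaMin M := by
  set σ := sigmaMin M with hσ
  have hσpos : 0 < σ := by linarith
  have hεσ : ε ≤ σ / 4 := by linarith
  obtain ⟨hcard, hlarge⟩ := D.kept_iff_large (η := η) hE (by linarith) (by rw [← hσ]; linarith)
  rw [← hσ] at hlarge
  set B := (D.truncatedU η)ᴴ * M' with hB
  set S : Matrix {i : Fin D.size // η ≤ D.s i} {i : Fin D.size // η ≤ D.s i} ℂ :=
    diagonal (fun i => (D.s i : ℂ)) with hS
  set T : Matrix {i : Fin D.size // η ≤ D.s i} {i : Fin D.size // η ≤ D.s i} ℂ :=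
    diagonal (fun i => (D.s i : ℂ)⁻¹) with hT
  have hBS : B = S * (D.truncatedV η)ᴴ := D.truncatedU_conjTranspose_mul η
  have hne : ∀ i : {i : Fin D.size // η ≤ D.s i}, (D.s i : ℂ) ≠ 0 := by
    intro i
    have : 0 < D.s i := by linarith [i.2]
    exact_mod_cast this.ne'
  have hST : S * T = 1 := by
    rw [hS, hT, diagonal_mul_diagonal, ← diagonal_one]
    congr 1; ext i; exact mul_inv_cancel₀ (hne i)
  have hTS : T * S = 1 := by
    rw [hS, hT, diagonal_mul_diagonal, ← diagonal_one]
    congr 1; ext i; exact inv_mul_cancel₀ (hne i)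
  have hBQ : B * (D.truncatedV η * T) = 1 := by
    rw [hBS, Matrix.mul_assoc, ← Matrix.mul_assoc _ (D.truncatedV η), D.truncatedV_isometry,
      Matrix.one_mul, hST]
  have hP : pinv B = D.truncatedV η * T := by
    refine (pinv_isMoorePenrose B).eq_of_mul_eq_one hBQ ?_
    rw [hBS, Matrix.mul_assoc, ← Matrix.mul_assoc T, hTS, Matrix.one_mul, conjTranspose_mul,
      conjTranspose_conjTranspose]
  -- The kept singular values are at least `σ - ε ≥ 3σ/4`, since `ε ≤ η/2 ≤ σ/4`. This is better
  -- than the inverse of the threshold `η`.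
  have hPn : ‖pinv B‖ ≤ 4 / (3 * σ) := by
    rw [hP]
    refine (l2_opNorm_mul _ _).trans ?_
    have h1 := opNorm_le_one_of_isometry (D.truncatedV_isometry η)
    refine (mul_le_of_le_one_left (norm_nonneg _) h1).trans ?_
    rw [hT, l2_opNorm_diagonal, pi_norm_le_iff_of_nonneg (by positivity)]
    intro i
    have h2 := hlarge i.1 i.2
    have h3 : 0 < D.s i := by linarith [i.2]
    rw [norm_inv, Complex.norm_real, Real.norm_of_nonneg h3.le, inv_le_comm₀ h3 (by positivity),
      inv_div]
    linarith
  have hBP : B * pinv B = 1 := by rw [hP, hBQ]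
  have h43 : 4 / (3 * σ) ≤ 2 / σ := by
    rw [div_le_div_iff₀ (by positivity) hσpos]; nlinarith
  refine ⟨hcard, hBP, hPn.trans h43, ?_⟩
  -- `pinv B` is an exact right inverse for `M'`, hence an approximate one for `M`. Correcting it by
  -- the inverse of a matrix `1/3`-close to the identity costs a factor `3/2`, and `4/(3σ) · 3/2 =
  -- 2/σ`.
  have hclose : ‖1 - (D.truncatedU η)ᴴ * M * pinv B‖ ≤ 1 / 3 := by
    have h1 : 1 - (D.truncatedU η)ᴴ * M * pinv B = (D.truncatedU η)ᴴ * ((M' - M) * pinv B) := by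
      rw [← hBP, hB]
      simp only [Matrix.sub_mul, Matrix.mul_sub, Matrix.mul_assoc]
    rw [h1]
    have h2 := opNorm_le_one_of_isometry (D.truncatedU_isometry η)
    rw [← l2_opNorm_conjTranspose] at h2
    refine (l2_opNorm_mul _ _).trans ((mul_le_of_le_one_left (norm_nonneg _) h2).trans ?_)
    refine (l2_opNorm_mul _ _).trans ?_
    calc ‖M' - M‖ * ‖pinv B‖ ≤ σ / 4 * (4 / (3 * σ)) :=
          mul_le_mul (hE.trans hεσ) hPn (norm_nonneg _) (by positivity)
      _ = 1 / 3 := by field_simp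
  obtain ⟨C, hC, hCn⟩ := exists_inverse_of_norm_one_sub_le (by norm_num) hclose
  refine ⟨pinv B * C, by rw [← Matrix.mul_assoc, hC], ?_⟩
  refine (l2_opNorm_mul _ _).trans ?_
  calc ‖pinv B‖ * ‖C‖ ≤ 4 / (3 * σ) * (1 - 1 / 3)⁻¹ :=
        mul_le_mul hPn hCn (norm_nonneg _) (by positivity)
    _ = 2 / σ := by field_simp; norm_num

end TruncatedSVD

/-! ### Local operators inside the chain algebra -/

section Embedding

variable {d N : ℕ}

/-- The configuration that is `u` on `I` and `g` elsewhere. -/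
def glue (I : Finset (Fin N)) (u : I → Fin d) (g : Fin N → Fin d) : Fin N → Fin d :=
  fun i => if h : i ∈ I then u ⟨i, h⟩ else g i

theorem glue_of_mem {I : Finset (Fin N)} (u : I → Fin d) (g : Fin N → Fin d) {i : Fin N}
    (h : i ∈ I) : glue I u g i = u ⟨i, h⟩ := dif_pos h

theorem glue_of_notMem {I : Finset (Fin N)} (u : I → Fin d) (g : Fin N → Fin d) {i : Fin N}
    (h : i ∉ I) : glue I u g i = g i := dif_neg h

theorem glue_restrict (I : Finset (Fin N)) (u : I → Fin d) (g : Fin N → Fin d) :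
    (fun i : I => glue I u g i) = u := by
  ext i; rw [glue_of_mem u g i.2]

theorem embed_apply (I : Finset (Fin N)) (x : Op d I) (g h : Fin N → Fin d) :
    embed I x g h = if ∀ i, i ∉ I → g i = h i then x (fun i => g i) (fun i => h i) else 0 := rfl

theorem embed_mul_embed_self (I : Finset (Fin N)) (x y : Op d I) :
    embed I (x * y) = embed I x * embed I y := by
  ext g h
  rw [Matrix.mul_apply, embed_apply]
  -- Only intermediate configurations that agree with `g` outside `I` contribute, and these are the
  -- `glue I u g`.
  have key : ∑ u : I → Fin d, embed I x g (glue I u g) * embed I y (glue I u g) h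
      = ∑ k, embed I x g k * embed I y k h := by
    refine Finset.sum_of_injOn (fun u => glue I u g) ?_
      (fun _ _ => Finset.mem_coe.2 (Finset.mem_univ _)) ?_ (fun _ _ => rfl)
    · intro u _ v _ huv
      rw [← glue_restrict I u g, ← glue_restrict I v g]
      exact congrArg (fun k => fun i : I => k i) huv
    · intro k _ hk
      have : ¬ ∀ i, i ∉ I → g i = k i := by
        intro hgk
        refine hk ⟨fun i => k i, Finset.mem_coe.2 (Finset.mem_univ _), ?_⟩
        ext i
        by_cases hi : i ∈ I
        · simp [glue_of_mem _ _ hi]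
        · simp [glue_of_notMem _ _ hi, hgk i hi]
      rw [embed_apply, if_neg this, zero_mul]
  rw [← key]
  have h1 : ∀ u : I → Fin d, embed I x g (glue I u g) = x (fun i => g i) u := by
    intro u
    rw [embed_apply, if_pos fun i hi => (glue_of_notMem u g hi).symm, glue_restrict]
  have h2 : ∀ u : I → Fin d, embed I y (glue I u g) h
      = if ∀ i, i ∉ I → g i = h i then y u (fun i => h i) else 0 := by
    intro u
    rw [embed_apply, glue_restrict]
    refine if_congr (forall₂_congr fun i hi => ?_) rfl rfl
    rw [glue_of_notMem u g hi]
  simp only [h1, h2]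
  split_ifs
  · rw [Matrix.mul_apply]
  · simp

theorem embed_mul_embed_apply {I J : Finset (Fin N)} (hIJ : Disjoint I J) (y : Op d I) (x : Op d J)
    (g h : Fin N → Fin d) : (embed I y * embed J x) g h
      = if ∀ i, i ∉ I → i ∉ J → g i = h i then
          y (fun i => g i) (fun i => h i) * x (fun i => g i) (fun i => h i) else 0 := by
  have hJI : ∀ i ∈ J, i ∉ I := fun i hJ hI => Finset.disjoint_left.1 hIJ hI hJ
  -- With disjoint supports a single intermediate configuration survives: `h` on `I` and `g`
  -- elsewhere.
  rw [Matrix.mul_apply, Finset.sum_eq_single (glue I (fun i => h i) g)]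
  · have h1 : (fun i : J => glue I (fun i => h i) g i) = fun i : J => g i := by
      ext i; rw [glue_of_notMem _ _ (hJI i i.2)]
    rw [embed_apply, embed_apply, glue_restrict, h1,
      if_pos fun i hi => (glue_of_notMem _ g hi).symm, mul_ite, mul_zero]
    refine if_congr ⟨fun H i hI hJ => ?_, fun H i hJ => ?_⟩ rfl rfl
    · rw [← H i hJ, glue_of_notMem _ _ hI]
    · by_cases hI : i ∈ I
      · rw [glue_of_mem _ _ hI]
      · rw [glue_of_notMem _ _ hI, H i hI hJ]
  · intro k _ hk
    rw [embed_apply, embed_apply]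
    by_cases hgk : ∀ i, i ∉ I → g i = k i
    · by_cases hkh : ∀ i, i ∉ J → k i = h i
      · refine absurd ?_ hk
        ext i
        by_cases hI : i ∈ I
        · rw [glue_of_mem _ _ hI, hkh i fun hJ => hJI i hJ hI]
        · rw [glue_of_notMem _ _ hI, hgk i hI]
      · rw [if_neg hkh, mul_zero]
    · rw [if_neg hgk, zero_mul]
  · simp

theorem embed_tens {I J : Finset (Fin N)} (hIJ : Disjoint I J) (y : Op d I) (x : Op d J) :
    embed (I ∪ J) (tens y x) = embed I y * embed J x := by
  ext g h
  rw [embed_mul_embed_apply hIJ, embed_apply]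
  refine if_congr ?_ rfl rfl
  simp only [Finset.mem_union, not_or, and_imp]

theorem embed_add (I : Finset (Fin N)) (x y : Op d I) :
    embed I (x + y) = embed I x + embed I y := by
  ext g h
  simp only [embed_apply, Matrix.add_apply]
  split_ifs <;> simp

theorem embed_smul (I : Finset (Fin N)) (c : ℂ) (x : Op d I) :
    embed I (c • x) = c • embed I x := by
  ext g h
  simp only [embed_apply, Matrix.smul_apply]
  split_ifs <;> simp

theorem embed_conjTranspose (I : Finset (Fin N)) (x : Op d I) :
    embed I xᴴ = (embed I x)ᴴ := by
  ext g h
  rw [conjTranspose_apply, embed_apply, embed_apply]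
  by_cases H : ∀ i, i ∉ I → g i = h i
  · rw [if_pos H, if_pos fun i hi => (H i hi).symm, conjTranspose_apply]
  · rw [if_neg H, if_neg fun H' => H fun i hi => (H' i hi).symm, star_zero]

theorem embed_one (I : Finset (Fin N)) : embed I (1 : Op d I) = 1 := by
  ext g h
  rw [embed_apply, Matrix.one_apply, Matrix.one_apply]
  by_cases H : g = h
  · simp [H]
  · rw [if_neg H]
    split_ifs with h1 h2
    · refine absurd ?_ H
      ext i
      by_cases hi : i ∈ I
      · rw [congrFun h2 ⟨i, hi⟩]
      · rw [h1 i hi]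
    · rfl
    · rfl

/-- `embed` as a linear map. -/
def embedLin (I : Finset (Fin N)) : Op d I →ₗ[ℂ] ChainOp d N where
  toFun := embed I
  map_add' := embed_add I
  map_smul' := embed_smul I

/-- `embed` as a homomorphism of star algebras. -/
def embedHom (I : Finset (Fin N)) : Op d I →⋆ₙₐ[ℂ] ChainOp d N where
  toFun := embed I
  map_zero' := (embedLin I).map_zero
  map_add' := embed_add I
  map_smul' := embed_smul I
  map_mul' := embed_mul_embed_self I
  map_star' := embed_conjTranspose I

/-- Homomorphisms of C*-algebras are contractive. -/
theorem norm_embed_le (I : Finset (Fin N)) (x : Op d I) : ‖embed I x‖ ≤ ‖x‖ :=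
  NonUnitalStarAlgHom.norm_apply_le (embedHom I) x

/-- The operators on the chain that are supported on `I`. -/
def supported (d : ℕ) (I : Finset (Fin N)) : Submodule ℂ (ChainOp d N) :=
  LinearMap.range (embedLin I)

theorem embed_mem_supported (I : Finset (Fin N)) (x : Op d I) : embed I x ∈ supported d I :=
  ⟨x, rfl⟩

theorem one_mem_supported (I : Finset (Fin N)) : (1 : ChainOp d N) ∈ supported d I :=
  ⟨1, embed_one I⟩

theorem supported_mono {I J : Finset (Fin N)} (hIJ : I ⊆ J) : supported d I ≤ supported d J := by
  rintro _ ⟨x, rfl⟩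
  refine ⟨of fun s t => if ∀ i (h : i ∈ J), i ∉ I → s ⟨i, h⟩ = t ⟨i, h⟩ then
    x (fun i => s ⟨i, hIJ i.2⟩) (fun i => t ⟨i, hIJ i.2⟩) else 0, ?_⟩
  ext g h
  change embed J _ g h = embed I x g h
  rw [embed_apply, embed_apply, of_apply]
  by_cases H : ∀ i, i ∉ I → g i = h i
  · rw [if_pos H, if_pos fun i hi => H i fun h' => hi (hIJ h'), if_pos fun i _ hi => H i hi]
  · rw [if_neg H]
    split_ifs with h1 h2
    · refine absurd (fun i hi => ?_) H
      by_cases hJ : i ∈ J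
      · exact h2 i hJ hi
      · exact h1 i hJ
    · rfl
    · rfl

theorem mul_mem_supported {I J K : Finset (Fin N)} (hIJ : Disjoint I J) (hI : I ⊆ K) (hJ : J ⊆ K)
    {Y X : ChainOp d N} (hY : Y ∈ supported d I) (hX : X ∈ supported d J) :
    Y * X ∈ supported d K := by
  obtain ⟨y, rfl⟩ := hY
  obtain ⟨x, rfl⟩ := hX
  exact supported_mono (Finset.union_subset hI hJ) ⟨tens y x, embed_tens hIJ y x⟩

theorem prodOp_union (X : Fin N → Matrix (Fin d) (Fin d) ℂ) {I J : Finset (Fin N)}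
    (hIJ : Disjoint I J) : prodOp X (I ∪ J) = tens (prodOp X I) (prodOp X J) := by
  ext s t
  simp only [prodOp, tens, of_apply]
  rw [← Fintype.prod_equiv (Equiv.Finset.union I J hIJ)
    (fun k => X ((Equiv.Finset.union I J hIJ k : ↥(I ∪ J)) : Fin N)
      (s (Equiv.Finset.union I J hIJ k)) (t (Equiv.Finset.union I J hIJ k))) _ (fun _ => rfl),
    Fintype.prod_sum_type]
  rfl

/-- The product operator `⨂_{s ∈ I} X_s`, acting on the chain. -/
def chainProd (X : Fin N → Matrix (Fin d) (Fin d) ℂ) (I : Finset (Fin N)) : ChainOp d N :=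
  embed I (prodOp X I)

theorem chainProd_union (X : Fin N → Matrix (Fin d) (Fin d) ℂ) {I J : Finset (Fin N)}
    (hIJ : Disjoint I J) : chainProd X (I ∪ J) = chainProd X I * chainProd X J := by
  rw [chainProd, prodOp_union X hIJ, embed_tens hIJ]; rfl

theorem chainProd_univ_single (s t : Fin N → Fin d) :
    chainProd (fun i => Matrix.single (t i) (s i) 1) Finset.univ = Matrix.single t s 1 := by
  ext g h
  rw [chainProd, embed_apply, if_pos fun i hi => absurd (Finset.mem_univ i) hi]
  simp only [prodOp, of_apply, Matrix.single_apply]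
  by_cases H : t = g ∧ s = h
  · rw [if_pos H]
    exact Finset.prod_eq_one fun i _ => if_pos ⟨congrFun H.1 i, congrFun H.2 i⟩
  · rw [if_neg H]
    have : ∃ i, ¬ (t i = g i ∧ s i = h i) := by
      by_contra! H'
      exact H ⟨funext fun i => (H' i).1, funext fun i => (H' i).2⟩
    obtain ⟨i, hi⟩ := this
    exact Finset.prod_eq_zero
      (Finset.mem_univ (⟨i, Finset.mem_univ i⟩ : (Finset.univ : Finset (Fin N)))) (if_neg hi)

end Embedding

/-! ### Slice maps and their norms -/

section Slices

variable {d N : ℕ}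

/-- A configuration of the chain as a pair of configurations of `Jᶜ` and `J`. -/
def splitEquiv (d : ℕ) (J : Finset (Fin N)) :
    (Fin N → Fin d) ≃ ((↥Jᶜ → Fin d) × (J → Fin d)) where
  toFun g := (fun i => g i, fun i => g i)
  invFun p := fun i => if h : i ∈ J then p.2 ⟨i, h⟩ else p.1 ⟨i, Finset.mem_compl.2 h⟩
  left_inv g := by ext i; by_cases h : i ∈ J <;> simp [h]
  right_inv p := by
    ext i
    · simp [Finset.mem_compl.1 i.2]
    · simp

theorem norm_le_of_sesquilinear_le {a : Type} [Fintype a] [DecidableEq a] (M : Matrix a a ℂ)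
    {C : ℝ} (hC : 0 ≤ C)
    (h : ∀ ξ ζ : a → ℂ, ‖star ξ ⬝ᵥ M *ᵥ ζ‖ ≤ C * ‖WithLp.toLp 2 ξ‖ * ‖WithLp.toLp 2 ζ‖) :
    ‖M‖ ≤ C := by
  refine opNorm_le_of_mulVec_le M hC fun v => ?_
  have h1 := h (M *ᵥ v) v
  rw [← norm_toLp_sq_eq_dotProduct, Complex.norm_real, Real.norm_of_nonneg (by positivity)] at h1
  rcases (norm_nonneg (WithLp.toLp 2 (M *ᵥ v))).eq_or_lt with h0 | h0
  · rw [← h0]; positivity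
  · refine le_of_mul_le_mul_left ?_ h0
    linarith

/-- The isometry (up to a factor) that tensors with the vector `ζ` on `Jᶜ`. -/
def tensorVec (J : Finset (Fin N)) (ζ : (↥Jᶜ → Fin d) → ℂ) :
    Matrix (Fin N → Fin d) (J → Fin d) ℂ :=
  of fun g u => if (fun i : J => g i) = u then ζ fun i => g i else 0

theorem norm_tensorVec_le (J : Finset (Fin N)) (ζ : (↥Jᶜ → Fin d) → ℂ) :
    ‖tensorVec J ζ‖ ≤ ‖WithLp.toLp 2 ζ‖ := by
  have h : (tensorVec J ζ)ᴴ * tensorVec J ζ = ((‖WithLp.toLp 2 ζ‖ ^ 2 : ℝ) : ℂ) • 1 := by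
    ext u v
    rw [Matrix.mul_apply, ← (splitEquiv d J).symm.sum_comp, Fintype.sum_prod_type_right,
      norm_toLp_sq_eq_dotProduct, Matrix.smul_apply, Matrix.one_apply]
    have h1 : ∀ w s, (tensorVec J ζ)ᴴ u ((splitEquiv d J).symm (s, w)) *
        tensorVec J ζ ((splitEquiv d J).symm (s, w)) v
        = if w = u then if w = v then star (ζ s) * ζ s else 0 else 0 := by
      intro w s
      have e1 : (fun i : ↥Jᶜ => (splitEquiv d J).symm (s, w) i) = s :=
        congrArg Prod.fst ((splitEquiv d J).apply_symm_apply (s, w))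
      have e2 : (fun i : J => (splitEquiv d J).symm (s, w) i) = w :=
        congrArg Prod.snd ((splitEquiv d J).apply_symm_apply (s, w))
      simp only [conjTranspose_apply, tensorVec, of_apply, e1, e2]
      split_ifs <;> simp
    simp only [h1]
    rw [Finset.sum_eq_single u]
    · by_cases huv : u = v
      · simp [huv, dotProduct]
      · simp [huv]
    · intro w _ hw
      simp [hw]
    · simp
  have h2 := l2_opNorm_conjTranspose_mul_self (tensorVec J ζ)
  rw [h, norm_smul, Complex.norm_real, Real.norm_of_nonneg (by positivity)] at h2
  have h3 : ‖(1 : Matrix (J → Fin d) (J → Fin d) ℂ)‖ ≤ 1 :=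
    opNorm_le_one_of_isometry (by simp)
  refine le_of_sq_le_sq ?_ (norm_nonneg _)
  rw [sq, ← h2]
  exact mul_le_of_le_one_right (by positivity) h3

/-- The block of `W` between the configurations `s` and `t` of `Jᶜ`. -/
def blockAt (J : Finset (Fin N)) (s t : ↥Jᶜ → Fin d) : ChainOp d N →ₗ[ℂ] Op d J where
  toFun W := of fun u v => W ((splitEquiv d J).symm (s, u)) ((splitEquiv d J).symm (t, v))
  map_add' _ _ := rfl
  map_smul' _ _ := rfl

theorem blockAt_apply (J : Finset (Fin N)) (s t : ↥Jᶜ → Fin d) (W : ChainOp d N) (u v : J → Fin d) :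
    blockAt J s t W u v = W ((splitEquiv d J).symm (s, u)) ((splitEquiv d J).symm (t, v)) := rfl

/-- Expresses a combination of blocks of `W` as a compression by tensoring with vectors. A
functional applied entrywise to the blocks can then be bounded by a single application to an
operator of norm at most `‖ξ‖ ‖W‖ ‖ζ‖`. -/
theorem sum_blockAt (J : Finset (Fin N)) (W : ChainOp d N) (ξ ζ : (↥Jᶜ → Fin d) → ℂ) :
    ∑ s, ∑ t, (star (ξ s) * ζ t) • blockAt J s t W
      = (tensorVec J ξ)ᴴ * W * tensorVec J ζ := by
  have hsum : ∀ (ζ : (↥Jᶜ → Fin d) → ℂ) (f : (Fin N → Fin d) → ℂ) (v : J → Fin d),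
      ∑ g, f g * tensorVec J ζ g v = ∑ s, f ((splitEquiv d J).symm (s, v)) * ζ s := by
    intro ζ f v
    rw [← (splitEquiv d J).symm.sum_comp, Fintype.sum_prod_type]
    refine Finset.sum_congr rfl fun s _ => ?_
    have h1 : ∀ w, tensorVec J ζ ((splitEquiv d J).symm (s, w)) v = if w = v then ζ s else 0 := by
      intro w
      have e1 : (fun i : ↥Jᶜ => (splitEquiv d J).symm (s, w) i) = s :=
        congrArg Prod.fst ((splitEquiv d J).apply_symm_apply (s, w))
      have e2 : (fun i : J => (splitEquiv d J).symm (s, w) i) = w :=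
        congrArg Prod.snd ((splitEquiv d J).apply_symm_apply (s, w))
      simp only [tensorVec, of_apply, e1, e2]
    simp [h1]
  ext u v
  rw [Matrix.mul_apply, hsum ζ]
  have h2 : ∀ h, ((tensorVec J ξ)ᴴ * W) u h
      = ∑ s, star (ξ s) * W ((splitEquiv d J).symm (s, u)) h := by
    intro h
    rw [Matrix.mul_apply]
    have h3 := congrArg star (hsum ξ (fun g => star (W g h)) u)
    rw [star_sum, star_sum] at h3
    simp only [star_mul', star_star] at h3
    simp only [conjTranspose_apply]
    rw [Finset.sum_congr rfl fun g _ => mul_comm _ _, h3]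
    exact Finset.sum_congr rfl fun g _ => mul_comm _ _
  simp only [h2, Finset.sum_mul]
  rw [Finset.sum_comm]
  simp only [Matrix.sum_apply, Matrix.smul_apply, blockAt_apply, smul_eq_mul]
  exact Finset.sum_congr rfl fun _ _ => Finset.sum_congr rfl fun _ _ => by ring

/-- Slice maps `id ⊗ φ` are bounded with the norm of `φ`. -/
theorem exists_slice (J : Finset (Fin N)) (φ : Op d J →ₗ[ℂ] ℂ) {C : ℝ} (hC : 0 ≤ C)
    (hφ : ∀ x, ‖φ x‖ ≤ C * ‖x‖) :
    ∃ S : ChainOp d N →ₗ[ℂ] ChainOp d N, (∀ W, ‖S W‖ ≤ C * ‖W‖) ∧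
      ∀ Y ∈ supported d Jᶜ, ∀ x, S (Y * embed J x) = φ x • Y := by
  let S₀ : ChainOp d N →ₗ[ℂ] Op d Jᶜ :=
    { toFun := fun W => of fun s t => φ (blockAt J s t W)
      map_add' := fun W W' => by ext s t; simp
      map_smul' := fun c W => by ext s t; simp }
  have hS₀ : ∀ W, ‖S₀ W‖ ≤ C * ‖W‖ := by
    intro W
    refine norm_le_of_sesquilinear_le _ (by positivity) fun ξ ζ => ?_
    -- The sesquilinear form of `id ⊗ φ` evaluated at `W` is `φ` of a compression of `W`, which is
    -- why no dimension factor appears.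
    have h1 : star ξ ⬝ᵥ S₀ W *ᵥ ζ = φ ((tensorVec J ξ)ᴴ * W * tensorVec J ζ) := by
      rw [← sum_blockAt]
      simp only [map_sum, map_smul, dotProduct, mulVec, Finset.mul_sum, Pi.star_apply, smul_eq_mul]
      refine Finset.sum_congr rfl fun s _ => Finset.sum_congr rfl fun t _ => ?_
      change star (ξ s) * (φ (blockAt J s t W) * ζ t) = _
      ring
    rw [h1]
    refine (hφ _).trans ?_
    rw [mul_assoc C, mul_assoc C]
    refine mul_le_mul_of_nonneg_left ?_ hC
    refine (l2_opNorm_mul _ _).trans ?_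
    have h2 := l2_opNorm_mul (tensorVec J ξ)ᴴ W
    rw [l2_opNorm_conjTranspose] at h2
    calc ‖(tensorVec J ξ)ᴴ * W‖ * ‖tensorVec J ζ‖
        ≤ (‖WithLp.toLp 2 ξ‖ * ‖W‖) * ‖WithLp.toLp 2 ζ‖ :=
          mul_le_mul (h2.trans (mul_le_mul_of_nonneg_right (norm_tensorVec_le J ξ) (norm_nonneg _)))
            (norm_tensorVec_le J ζ) (norm_nonneg _) (by positivity)
      _ = _ := by ring
  refine ⟨(embedLin Jᶜ).comp S₀, fun W => (norm_embed_le _ _).trans (hS₀ W), ?_⟩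
  rintro _ ⟨y, rfl⟩ x
  have hdisj : Disjoint Jᶜ J := disjoint_compl_left
  rw [LinearMap.comp_apply, ← map_smul]
  congr 1
  ext s t
  change φ (blockAt J s t (embed Jᶜ y * embed J x)) = φ x * y s t
  have h1 : blockAt J s t (embed Jᶜ y * embed J x) = y s t • x := by
    ext u v
    change (embed Jᶜ y * embed J x) _ _ = y s t * x u v
    have e : ∀ (s : ↥Jᶜ → Fin d) (u : J → Fin d),
        (fun i : ↥Jᶜ => (splitEquiv d J).symm (s, u) i) = s ∧
        (fun i : J => (splitEquiv d J).symm (s, u) i) = u := fun s u =>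
      ⟨congrArg Prod.fst ((splitEquiv d J).apply_symm_apply (s, u)),
       congrArg Prod.snd ((splitEquiv d J).apply_symm_apply (s, u))⟩
    rw [embed_mul_embed_apply hdisj, if_pos, (e s u).1, (e s u).2, (e t v).1, (e t v).2]
    intro i hi hi'
    exact absurd (Finset.mem_compl.2 hi') hi
  rw [h1, map_smul, smul_eq_mul, mul_comm]

end Slices

/-! ### States are contractive functionals -/

section States

variable {a : Type} [Fintype a]

theorem norm_star_dotProduct_le (v w : a → ℂ) :
    ‖star v ⬝ᵥ w‖ ≤ ‖WithLp.toLp 2 v‖ * ‖WithLp.toLp 2 w‖ := by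
  have h := norm_inner_le_norm (𝕜 := ℂ) (WithLp.toLp 2 v) (WithLp.toLp 2 w)
  rw [EuclideanSpace.inner_eq_star_dotProduct, dotProduct_comm] at h
  exact h

variable [DecidableEq a]

open scoped MatrixOrder in
theorem exists_eq_conjTranspose_mul_self {A : Matrix a a ℂ} (hA : A.PosSemidef) :
    ∃ B : Matrix a a ℂ, A = Bᴴ * B :=
  CStarAlgebra.nonneg_iff_eq_star_mul_self.mp hA.nonneg

theorem trace_mul_nonneg {A E : Matrix a a ℂ} (hA : A.PosSemidef) (hE : E.PosSemidef) :
    0 ≤ (A * E).trace := by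
  obtain ⟨B, rfl⟩ := exists_eq_conjTranspose_mul_self hA
  rw [Matrix.mul_assoc, trace_mul_comm]
  have h := hE.conjTranspose_mul_mul_same Bᴴ
  rw [conjTranspose_conjTranspose] at h
  exact h.trace_nonneg

/-- Writing `ρ = Bᴴ B` turns the expectation into a sum of terms `⟨v_i, Z v_i⟩` with `∑ ‖v_i‖² = tr
ρ = 1`. -/
theorem norm_trace_mul_le {ρ : Matrix a a ℂ} (hρ : IsState ρ) (Z : Matrix a a ℂ) :
    ‖(ρ * Z).trace‖ ≤ ‖Z‖ := by
  obtain ⟨B, rfl⟩ := exists_eq_conjTranspose_mul_self hρ.1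
  have hdiag : ∀ (i : a) (Z : Matrix a a ℂ),
      (B * Z * Bᴴ) i i = star (star (B i)) ⬝ᵥ Z *ᵥ star (B i) := by
    intro i Z
    rw [Matrix.mul_assoc, Matrix.mul_apply, star_star]
    rfl
  have h1 : ∀ Z, (Bᴴ * B * Z).trace = ∑ i, star (star (B i)) ⬝ᵥ Z *ᵥ star (B i) := by
    intro Z
    rw [Matrix.mul_assoc, trace_mul_comm, trace]
    exact Finset.sum_congr rfl fun i _ => hdiag i Z
  have htr : ∑ i, ‖WithLp.toLp 2 (star (B i))‖ ^ 2 = 1 := by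
    apply Complex.ofReal_injective
    have h2 := h1 1
    rw [Matrix.mul_one, hρ.2] at h2
    push_cast
    rw [h2]
    refine Finset.sum_congr rfl fun i _ => ?_
    rw [one_mulVec, ← norm_toLp_sq_eq_dotProduct]
    push_cast
    rfl
  rw [h1]
  calc ‖∑ i, star (star (B i)) ⬝ᵥ Z *ᵥ star (B i)‖
      ≤ ∑ i, ‖star (star (B i)) ⬝ᵥ Z *ᵥ star (B i)‖ := norm_sum_le _ _
    _ ≤ ∑ i, ‖Z‖ * ‖WithLp.toLp 2 (star (B i))‖ ^ 2 := by
        refine Finset.sum_le_sum fun i _ => (norm_star_dotProduct_le _ _).trans ?_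
        have := norm_toLp_mulVec_le Z (star (B i))
        nlinarith [norm_nonneg (WithLp.toLp 2 (star (B i)))]
    _ = ‖Z‖ := by rw [← Finset.mul_sum, htr, mul_one]

end States

/-! ### Marginals are states -/

section Marginals

variable {d N : ℕ}

theorem trace_marginal_mul (ρ : ChainOp d N) (I : Finset (Fin N)) (X : Op d I) :
    (marginal ρ I * X).trace = (ρ * embed I X).trace := by
  have h1 : X = ∑ t, ∑ s, X t s • Matrix.single t s (1 : ℂ) := by
    conv_lhs => rw [matrix_eq_sum_single X]
    simp [Matrix.smul_single]
  have h2 : embed I X = ∑ t, ∑ s, X t s • embed I (Matrix.single t s (1 : ℂ)) := by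
    conv_lhs => rw [h1]
    change embedLin I _ = _
    simp only [map_sum, map_smul]
    rfl
  rw [h2]
  simp only [Matrix.mul_sum, trace_sum, Matrix.mul_smul, trace_smul, smul_eq_mul]
  rw [Finset.sum_comm, trace]
  refine Finset.sum_congr rfl fun s _ => ?_
  rw [diag_apply, Matrix.mul_apply]
  exact Finset.sum_congr rfl fun t _ => mul_comm _ _

theorem posSemidef_embed {I : Finset (Fin N)} {x : Op d I} (hx : x.PosSemidef) :
    (embed I x).PosSemidef := by
  obtain ⟨B, rfl⟩ := exists_eq_conjTranspose_mul_self hx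
  rw [embed_mul_embed_self, embed_conjTranspose]
  exact posSemidef_conjTranspose_mul_self _

theorem isState_marginal {ρ : ChainOp d N} (hρ : IsState ρ) (I : Finset (Fin N)) :
    IsState (marginal ρ I) := by
  refine ⟨PosSemidef.of_dotProduct_mulVec_nonneg ?_ fun v => ?_, ?_⟩
  · ext s t
    have h : embed I (Matrix.single t s (1 : ℂ)) = (embed I (Matrix.single s t (1 : ℂ)))ᴴ := by
      rw [← embed_conjTranspose, conjTranspose_single, star_one]
    change star (ρ * embed I (Matrix.single s t 1)).trace
      = (ρ * embed I (Matrix.single t s 1)).trace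
    rw [h, ← trace_conjTranspose, conjTranspose_mul, hρ.1.isHermitian.eq, trace_mul_comm]
  · have h : star v ⬝ᵥ marginal ρ I *ᵥ v = (marginal ρ I * vecMulVec v (star v)).trace := by
      rw [mul_vecMulVec, trace_vecMulVec, dotProduct_comm]
    rw [h, trace_marginal_mul]
    exact trace_mul_nonneg hρ.1 (posSemidef_embed (posSemidef_vecMulVec_self_star v))
  · have h := trace_marginal_mul ρ I 1
    rw [Matrix.mul_one, embed_one, Matrix.mul_one] at h
    rw [h, hρ.2]

/-- Since `‖ρ‖₂² = tr(ρ ρᴴ) ≤ ‖ρᴴ‖ ≤ ‖ρ‖₂`, the Frobenius norm is at most `1`. -/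
theorem frobSq_le_one_of_isState {a : Type} [Fintype a] [DecidableEq a] {ρ : Matrix a a ℂ}
    (hρ : IsState ρ) : frobSq ρ ≤ 1 := by
  have h1 : ((frobSq ρ : ℝ) : ℂ) = (ρ * ρᴴ).trace := by
    rw [frobSq, trace]
    push_cast
    refine Finset.sum_congr rfl fun i _ => ?_
    rw [diag_apply, Matrix.mul_apply]
    refine Finset.sum_congr rfl fun j _ => ?_
    rw [conjTranspose_apply, RCLike.star_def, Complex.mul_conj']
  have h2 := norm_trace_mul_le hρ ρᴴ
  rw [← h1, Complex.norm_real, Real.norm_of_nonneg (frobSq_nonneg ρ)] at h2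
  have h3 := opNorm_le_sqrt_frobSq ρᴴ
  rw [frobSq_conjTranspose] at h3
  have h4 := Real.sq_sqrt (frobSq_nonneg ρ)
  nlinarith [Real.sqrt_nonneg (frobSq ρ)]

theorem hsNorm_sq {a : Type} [Fintype a] (M : Matrix a a ℂ) : hsNorm M ^ 2 = frobSq M :=
  Real.sq_sqrt (frobSq_nonneg M)

end Marginals

/-! ### Correlation maps as reshuffled marginals -/

section OmegaMaps

variable {d N : ℕ} {I S J : Finset (Fin N)}

/-- `tens` as a bilinear map. -/
def tensBilin (I J : Finset (Fin N)) : Op d I →ₗ[ℂ] Op d J →ₗ[ℂ] Op d (I ∪ J) :=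
  LinearMap.mk₂ ℂ tens
    (fun _ _ _ => by ext; simp [tens, add_mul]) (fun _ _ _ => by ext; simp [tens, mul_assoc])
    (fun _ _ _ => by ext; simp [tens, mul_add]) (fun _ _ _ => by ext; simp [tens, mul_left_comm])

/-- The operator with coefficients `u` in the basis of matrix units. -/
def opOf (u : OpIdx d I → ℂ) : Op d I := of fun s t => u (s, t)

theorem opOf_eq_sum (u : OpIdx d I → ℂ) : opOf u = ∑ p, u p • unit p := by
  ext s t
  rw [Matrix.sum_apply, Finset.sum_eq_single (s, t)]
  · simp [opOf, unit]
  · rintro ⟨s', t'⟩ _ hne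
    have : ¬ (s' = s ∧ t' = t) := fun h => hne (by rw [h.1, h.2])
    simp [unit, this]
  · simp

theorem opOf_entries (x : Op d I) : opOf (fun p => x p.1 p.2) = x := rfl

theorem opOf_single (p : OpIdx d I) : opOf (Pi.single p 1) = unit p := by
  rw [opOf_eq_sum, Finset.sum_eq_single p]
  · simp
  · intro q _ hq; simp [hq]
  · simp

theorem norm_opOf_sq_le (u : OpIdx d I → ℂ) : ‖opOf u‖ ^ 2 ≤ ∑ p, ‖u p‖ ^ 2 := by
  have h := pow_le_pow_left₀ (norm_nonneg _) (opNorm_le_sqrt_frobSq (opOf u)) 2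
  rw [Real.sq_sqrt (frobSq_nonneg _), frobSq] at h
  rw [Fintype.sum_prod_type]
  exact h

theorem mul_omegaMap_mul_apply {m n : Type} (A : Matrix m (OpIdx d I) ℂ)
    (τ : Op d (I ∪ J)) (R : Matrix (OpIdx d J) n ℂ) (i : m) (j : n) :
    (A * omegaMap τ * R) i j
      = (τ * tens (opOf (A i)) (opOf fun q => R q j)).trace := by
  change _ = (τ * tensBilin I J (opOf (A i)) (opOf fun q => R q j)).trace
  rw [opOf_eq_sum, opOf_eq_sum]
  simp only [map_sum, map_smul, LinearMap.sum_apply, LinearMap.smul_apply, Matrix.mul_sum,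
    trace_sum, Matrix.mul_smul, trace_smul, smul_eq_mul]
  rw [Matrix.mul_apply]
  simp only [Matrix.mul_apply, Finset.sum_mul]
  refine Finset.sum_congr rfl fun q _ => ?_
  rw [Finset.mul_sum]
  refine Finset.sum_congr rfl fun p _ => ?_
  change A i p * (τ * tens (unit p) (unit q)).trace * R q j
    = R q j * (A i p * (τ * tens (unit p) (unit q)).trace)
  ring

theorem mul_omegaMap_marginal_mul_apply {m n : Type} (hIJ : Disjoint I J) (ρ : ChainOp d N)
    (A : Matrix m (OpIdx d I) ℂ) (R : Matrix (OpIdx d J) n ℂ) (i : m) (j : n) :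
    (A * omegaMap (marginal ρ (I ∪ J)) * R) i j
      = (ρ * (embed I (opOf (A i)) * embed J (opOf fun q => R q j))).trace := by
  rw [mul_omegaMap_mul_apply, trace_marginal_mul, embed_tens hIJ]

/-- `omegaMapAt` as `omegaMap` evaluated on `Y ⊗ A`. -/
theorem mul_omegaMapAt_mul_apply {m n : Type} (A : Matrix m (OpIdx d I) ℂ)
    (τ : Op d ((I ∪ S) ∪ J)) (X : Op d S) (R : Matrix (OpIdx d J) n ℂ) (i : m) (j : n) :
    (A * omegaMapAt τ X * R) i j
      = (τ * tens (tens (opOf (A i)) X) (opOf fun q => R q j)).trace := by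
  have h : A * omegaMapAt τ X
      = (of fun i (p : OpIdx d (I ∪ S)) => tens (opOf (A i)) X p.1 p.2) * omegaMap τ := by
    ext i q
    have h1 := mul_omegaMap_mul_apply (of fun i (p : OpIdx d (I ∪ S)) =>
      tens (opOf (A i)) X p.1 p.2) τ (1 : Matrix (OpIdx d J) (OpIdx d J) ℂ) i q
    rw [Matrix.mul_one] at h1
    rw [h1]
    have h2 : (fun q' => (1 : Matrix (OpIdx d J) (OpIdx d J) ℂ) q' q) = Pi.single q 1 := by
      ext q'; simp [Matrix.one_apply, Pi.single_apply]
    have h3 : opOf ((of fun i (p : OpIdx d (I ∪ S)) => tens (opOf (A i)) X p.1 p.2) i)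
      = tens (opOf (A i)) X := rfl
    rw [h2, opOf_single, h3, Matrix.mul_apply]
    change _ = (τ * tensBilin (I ∪ S) J (tensBilin I S (opOf (A i)) X) (unit q)).trace
    rw [opOf_eq_sum]
    simp only [map_sum, map_smul, LinearMap.sum_apply, LinearMap.smul_apply, Matrix.mul_sum,
      trace_sum, Matrix.mul_smul, trace_smul, smul_eq_mul]
    rfl
  rw [h, mul_omegaMap_mul_apply]
  rfl

theorem mul_omegaMapAt_marginal_mul_apply {m n : Type} (hIS : Disjoint I S)
    (hISJ : Disjoint (I ∪ S) J) (ρ : ChainOp d N) (A : Matrix m (OpIdx d I) ℂ) (X : Op d S)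
    (R : Matrix (OpIdx d J) n ℂ) (i : m) (j : n) :
    (A * omegaMapAt (marginal ρ ((I ∪ S) ∪ J)) X * R) i j
      = (ρ * (embed I (opOf (A i)) * embed S X * embed J (opOf fun q => R q j))).trace := by
  rw [mul_omegaMapAt_mul_apply, trace_marginal_mul, embed_tens hISJ, embed_tens hIS]

/-- The index of `unit p ⊗ unit q`. -/
def joinIdx (hIJ : Disjoint I J) : OpIdx d I × OpIdx d J ≃ OpIdx d (I ∪ J) :=
  (Equiv.prodProdProdComm _ _ _ _).trans
    ((Equiv.piFinsetUnion (fun _ => Fin d) hIJ).prodCongr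
      (Equiv.piFinsetUnion (fun _ => Fin d) hIJ))

theorem tens_unit (hIJ : Disjoint I J) (p : OpIdx d I) (q : OpIdx d J) :
    tens (unit p) (unit q) = unit (joinIdx hIJ (p, q)) := by
  have key : ∀ (u : I → Fin d) (v : J → Fin d) (s : ↥(I ∪ J) → Fin d),
      Equiv.piFinsetUnion (fun _ => Fin d) hIJ (u, v) = s ↔
        u = (fun i : I => s ⟨i, Finset.mem_union_left J i.2⟩) ∧
        v = (fun i : J => s ⟨i, Finset.mem_union_right I i.2⟩) := by
    intro u v s
    rw [← Equiv.eq_symm_apply, Prod.ext_iff]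
    rfl
  ext s t
  simp only [tens, unit, of_apply, Matrix.single_apply, joinIdx, Equiv.trans_apply,
    Equiv.prodProdProdComm_apply, Equiv.prodCongr_apply, Prod.map, key]
  split_ifs <;> first | (exfalso; tauto) | simp

theorem omegaMap_apply_eq (hIJ : Disjoint I J) (τ : Op d (I ∪ J)) (p : OpIdx d I)
    (q : OpIdx d J) : omegaMap τ p q = τ (joinIdx hIJ (p, q)).2 (joinIdx hIJ (p, q)).1 := by
  change (τ * tens (unit p) (unit q)).trace = _
  rw [tens_unit hIJ, unit, trace_mul_single]
  simp

/-- Products of matrix units are the matrix units of the larger block, so the entries of `Ω` are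
those of `τ` in another arrangement. Hilbert-Schmidt errors of marginals thus become errors of
correlation maps without loss. -/
theorem frobSq_omegaMap (hIJ : Disjoint I J) (τ : Op d (I ∪ J)) :
    frobSq (omegaMap τ) = frobSq τ := by
  unfold frobSq
  simp only [omegaMap_apply_eq hIJ]
  rw [← Fintype.sum_prod_type', (joinIdx hIJ).sum_comp (fun P => ‖τ P.2 P.1‖ ^ 2),
    Fintype.sum_prod_type, Finset.sum_comm]

theorem omegaMapAt_unit (hIS : Disjoint I S) (τ : Op d ((I ∪ S) ∪ J)) (c : OpIdx d S)
    (p : OpIdx d I) (q : OpIdx d J) :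
    omegaMapAt τ (unit c) p q = omegaMap τ (joinIdx hIS (p, c)) q := by
  change (τ * tens (tens (unit p) (unit c)) (unit q)).trace = _
  rw [tens_unit hIS]
  rfl

/-- Letting the middle operator run through the matrix units distributes every entry of `τ` over
exactly one of the maps. The total error over all units of a site is therefore that of one marginal,
with no extra power of `d`. -/
theorem sum_frobSq_omegaMapAt (hIS : Disjoint I S) (hISJ : Disjoint (I ∪ S) J)
    (τ : Op d ((I ∪ S) ∪ J)) : ∑ c, frobSq (omegaMapAt τ (unit c)) = frobSq τ := by
  rw [← frobSq_omegaMap hISJ]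
  unfold frobSq
  simp only [omegaMapAt_unit hIS]
  rw [Finset.sum_comm, ← Fintype.sum_prod_type',
    (joinIdx hIS).sum_comp (fun P => ∑ q, ‖omegaMap τ P q‖ ^ 2)]

theorem omegaMap_sub (τ τ' : Op d (I ∪ J)) : omegaMap (τ - τ') = omegaMap τ - omegaMap τ' := by
  ext p q
  simp [omegaMap, Matrix.sub_mul]

theorem omegaMapAt_sub (τ τ' : Op d ((I ∪ S) ∪ J)) (A : Op d S) :
    omegaMapAt (τ - τ') A = omegaMapAt τ A - omegaMapAt τ' A := by
  ext p q
  simp [omegaMapAt, Matrix.sub_mul]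

/-- `A ↦ omegaMapAt τ A` as a linear map. -/
def omegaMapAtLin (τ : Op d ((I ∪ S) ∪ J)) :
    Op d S →ₗ[ℂ] Matrix (OpIdx d I) (OpIdx d J) ℂ where
  toFun := omegaMapAt τ
  map_add' A B := by
    ext p q
    change (τ * tensBilin _ _ (tensBilin _ _ (unit p) (A + B)) (unit q)).trace
      = (τ * tensBilin _ _ (tensBilin _ _ (unit p) A) (unit q)).trace
        + (τ * tensBilin _ _ (tensBilin _ _ (unit p) B) (unit q)).trace
    simp [Matrix.mul_add]
  map_smul' c A := by
    ext p q
    change (τ * tensBilin _ _ (tensBilin _ _ (unit p) (c • A)) (unit q)).trace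
      = c • (τ * tensBilin _ _ (tensBilin _ _ (unit p) A) (unit q)).trace
    simp

end OmegaMaps

/-! ### Monotonicity of outcome probabilities -/

section Monotonicity

/-- The matrix is a Hadamard product of pullbacks of the `M i` to the product index set, so the
Schur product theorem applies factor by factor. -/
theorem posSemidef_prod_hadamard {ι : Type} [Fintype ι] {α : ι → Type} [∀ i, Fintype (α i)]
    (M : ∀ i, Matrix (α i) (α i) ℂ) (hM : ∀ i, (M i).PosSemidef) :
    (of fun s t : ∀ i, α i => ∏ i, M i (s i) (t i)).PosSemidef := by
  classical
  have key : ∀ F : Finset ι,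
      (of fun s t : ∀ i, α i => ∏ i ∈ F, M i (s i) (t i)).PosSemidef := by
    intro F
    induction F using Finset.induction_on with
    | empty =>
      have h : (of fun s t : ∀ i, α i => ∏ i ∈ ∅, M i (s i) (t i))
          = vecMulVec (1 : (∀ i, α i) → ℂ) (star 1) := by
        ext s t; simp [vecMulVec_apply]
      rw [h]
      exact posSemidef_vecMulVec_self_star _
    | insert i F hi ih =>
      have h : (of fun s t : ∀ i, α i => ∏ i ∈ insert i F, M i (s i) (t i))
          = ((M i).submatrix (fun s : ∀ i, α i => s i) (fun s => s i)) ⊙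
            (of fun s t : ∀ i, α i => ∏ i ∈ F, M i (s i) (t i)) := by
        ext s t
        simp [Finset.prod_insert hi]
      rw [h]
      exact ((hM i).submatrix _).hadamard ih
  exact key Finset.univ

/-- Each outcome has nonnegative probability, so enlarging the event cannot decrease the sum. This
is all that the statement about measurements needs beyond the deterministic error bound. -/
theorem LocalMeasurement.prob_mono {d N l r n : ℕ} (T : LocalMeasurement d N l r n)
    {ρ : ChainOp d N} (hρ : IsState ρ) {P Q : Fin T.outcomes → Prop} (hPQ : ∀ x, P x → Q x) :
    T.prob ρ P ≤ T.prob ρ Q := by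
  classical
  unfold LocalMeasurement.prob
  have hpos : (T.copies ρ).PosSemidef :=
    posSemidef_prod_hadamard (fun c => marginal ρ (block N (T.start c) (T.start c + l + r)))
      fun c => (isState_marginal hρ _).1
  refine Finset.sum_le_sum_of_subset_of_nonneg (fun x hx => ?_) fun x _ _ =>
    (Complex.nonneg_iff.1 (trace_mul_nonneg hpos (T.effect_pos x))).1
  simp only [Finset.mem_filter, Finset.mem_univ, true_and] at hx ⊢
  exact hPQ x hx

end Monotonicity

/-! ### Intervals of sites -/

section Blocks

variable {N : ℕ}

theorem mem_block {i j : ℕ} {s : Fin N} :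
    s ∈ block N i j ↔ i ≤ (s : ℕ) + 1 ∧ (s : ℕ) + 1 ≤ j := by
  simp [block]

theorem disjoint_block {i j i' j' : ℕ} (h : j < i') : Disjoint (block N i j) (block N i' j') := by
  rw [Finset.disjoint_left]
  intro s hs hs'
  rw [mem_block] at hs hs'
  omega

theorem block_subset_block {i j i' j' : ℕ} (hi : i' ≤ i ∨ i' ≤ 1) (hj : j ≤ j' ∨ N ≤ j') :
    block N i j ⊆ block N i' j' := by
  intro s hs
  rw [mem_block] at hs ⊢
  have := s.2
  omega

theorem block_subset_compl {i j i' j' : ℕ} (h : j < i' ∨ j' < i) :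
    block N i j ⊆ (block N i' j')ᶜ := by
  intro s hs
  rw [Finset.mem_compl]
  intro hs'
  rw [mem_block] at hs hs'
  omega

theorem block_one_succ (k : ℕ) : block N 1 (k + 1) = block N 1 k ∪ block N (k + 1) (k + 1) := by
  ext s
  rw [Finset.mem_union, mem_block, mem_block, mem_block]
  omega

theorem block_one_self : block N 1 N = Finset.univ := by
  ext s
  have := s.2
  simp only [mem_block, Finset.mem_univ, iff_true]
  omega

theorem block_eq_empty {i j : ℕ} (h : j < i ∨ N < i ∨ j = 0) : block N i j = ∅ := by
  ext s
  have := s.2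
  simp only [mem_block, Finset.notMem_empty, iff_false]
  omega

theorem card_block_singleton {k : ℕ} (hk : k < N) : (block N (k + 1) (k + 1)).card = 1 := by
  rw [Finset.card_eq_one]
  refine ⟨⟨k, hk⟩, ?_⟩
  ext s
  rw [mem_block, Finset.mem_singleton, Fin.ext_iff]
  dsimp only
  omega

theorem disjoint_leftWin_rightWin (N l r j : ℕ) : Disjoint (leftWin N l j) (rightWin N r j) :=
  disjoint_block (Nat.lt_succ_self j)

theorem disjoint_leftWin_site (N l k : ℕ) :
    Disjoint (leftWin N l k) (block N (k + 1) (k + 1)) :=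
  disjoint_block (Nat.lt_succ_self k)

theorem disjoint_leftWin_union_site (N l r k : ℕ) :
    Disjoint (leftWin N l k ∪ block N (k + 1) (k + 1)) (rightWin N r (k + 1)) :=
  Finset.disjoint_union_left.2
    ⟨disjoint_block (by omega), disjoint_block (Nat.lt_succ_self (k + 1))⟩

end Blocks

/-! ### Expectations and operators given by rows and columns -/

section Expectation

variable {d N : ℕ}

/-- The functional `X ↦ tr(ρ X)`. -/
def expect (ρ : ChainOp d N) : ChainOp d N →ₗ[ℂ] ℂ :=
  (traceLinearMap (Fin N → Fin d) ℂ ℂ).comp (LinearMap.mulLeft ℂ ρ)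

theorem expect_apply (ρ X : ChainOp d N) : expect ρ X = (ρ * X).trace := rfl

theorem norm_expect_le {ρ : ChainOp d N} (hρ : IsState ρ) (X : ChainOp d N) :
    ‖expect ρ X‖ ≤ ‖X‖ := norm_trace_mul_le hρ X

theorem expect_one {ρ : ChainOp d N} (hρ : IsState ρ) : expect ρ 1 = 1 := by
  rw [expect_apply, Matrix.mul_one, hρ.2]

/-- The operator on the chain whose coefficients are a row of `f`. -/
def rowOp {I : Finset (Fin N)} {α : Type} (f : Matrix α (OpIdx d I) ℂ) (a : α) : ChainOp d N :=
  embed I (opOf (f a))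

/-- The operator on the chain whose coefficients are a column of `R`. -/
def colOp {J : Finset (Fin N)} {β : Type} (R : Matrix (OpIdx d J) β ℂ) (b : β) : ChainOp d N :=
  embed J (opOf fun q => R q b)

theorem rowOp_mem_supported {I : Finset (Fin N)} {α : Type} (f : Matrix α (OpIdx d I) ℂ) (a : α) :
    rowOp f a ∈ supported d I := embed_mem_supported _ _

theorem colOp_mem_supported {J : Finset (Fin N)} {β : Type} (R : Matrix (OpIdx d J) β ℂ) (b : β) :
    colOp R b ∈ supported d J := embed_mem_supported _ _

theorem norm_colOp_le {J : Finset (Fin N)} {β : Type} [Fintype β] [DecidableEq β]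
    (R : Matrix (OpIdx d J) β ℂ) (b : β) : ‖colOp R b‖ ≤ ‖R‖ :=
  (norm_embed_le _ _).trans
    (le_of_sq_le_sq ((norm_opOf_sq_le _).trans (sum_sq_col_le R b)) (norm_nonneg _))

theorem norm_rowOp_le {I : Finset (Fin N)} {α : Type} [Fintype α] [DecidableEq α]
    (f : Matrix α (OpIdx d I) ℂ) (a : α) : ‖rowOp f a‖ ≤ ‖f‖ := by
  have h := sum_sq_col_le fᴴ a
  rw [l2_opNorm_conjTranspose] at h
  simp only [conjTranspose_apply, norm_star] at h
  exact (norm_embed_le _ _).trans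
    (le_of_sq_le_sq ((norm_opOf_sq_le _).trans h) (norm_nonneg _))

theorem expect_rowOp_mul_colOp {I J : Finset (Fin N)} (hIJ : Disjoint I J) (ρ : ChainOp d N)
    {α β : Type} (f : Matrix α (OpIdx d I) ℂ) (R : Matrix (OpIdx d J) β ℂ) (a : α) (b : β) :
    expect ρ (rowOp f a * colOp R b) = (f * omegaMap (marginal ρ (I ∪ J)) * R) a b :=
  (mul_omegaMap_marginal_mul_apply hIJ ρ f R a b).symm

theorem expect_rowOp_mul_embed_mul_colOp {I S J : Finset (Fin N)} (hIS : Disjoint I S)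
    (hISJ : Disjoint (I ∪ S) J) (ρ : ChainOp d N) {α β : Type} (f : Matrix α (OpIdx d I) ℂ)
    (A : Op d S) (R : Matrix (OpIdx d J) β ℂ) (a : α) (b : β) :
    expect ρ (rowOp f a * embed S A * colOp R b)
      = (f * omegaMapAt (marginal ρ ((I ∪ S) ∪ J)) A * R) a b :=
  (mul_omegaMapAt_marginal_mul_apply hIS hISJ ρ f A R a b).symm

end Expectation

/-! ### The correction superoperator and one hybrid step -/

section Corrections

variable {d N : ℕ} {α β : Type} [Fintype α] [Fintype β]

/-- Cauchy-Schwarz in the basis of matrix units, with `‖A‖₂² ≤ d^|I| ‖A‖²`. Applied to a single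
site, this is the only origin of `√d` in the error. -/
theorem norm_functional_le {I : Finset (Fin N)} (φ : Op d I →ₗ[ℂ] ℂ) (A : Op d I) :
    ‖φ A‖ ≤ √((d : ℝ) ^ I.card) * √(∑ c, ‖φ (unit c)‖ ^ 2) * ‖A‖ := by
  have h1 : φ A = ∑ c : OpIdx d I, A c.1 c.2 * φ (unit c) := by
    conv_lhs => rw [← opOf_entries A, opOf_eq_sum]
    simp
  have h2 : ∑ c : OpIdx d I, ‖A c.1 c.2‖ ^ 2 ≤ (d : ℝ) ^ I.card * ‖A‖ ^ 2 := by
    rw [Fintype.sum_prod_type]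
    have := frobSq_le_card_mul A
    simpa [frobSq] using this
  refine le_of_sq_le_sq ?_ (by positivity)
  rw [mul_pow, mul_pow, Real.sq_sqrt (by positivity), Real.sq_sqrt (by positivity), h1]
  have h3 : ‖∑ c : OpIdx d I, A c.1 c.2 * φ (unit c)‖
      ≤ ∑ c : OpIdx d I, ‖A c.1 c.2‖ * ‖φ (unit c)‖ :=
    (norm_sum_le _ _).trans_eq (by simp)
  calc ‖∑ c : OpIdx d I, A c.1 c.2 * φ (unit c)‖ ^ 2
      ≤ (∑ c : OpIdx d I, ‖A c.1 c.2‖ * ‖φ (unit c)‖) ^ 2 :=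
        pow_le_pow_left₀ (norm_nonneg _) h3 2
    _ ≤ (∑ c : OpIdx d I, ‖A c.1 c.2‖ ^ 2) * ∑ c, ‖φ (unit c)‖ ^ 2 :=
        Finset.sum_mul_sq_le_sq_mul_sq _ _ _
    _ ≤ ((d : ℝ) ^ I.card * ‖A‖ ^ 2) * ∑ c, ‖φ (unit c)‖ ^ 2 :=
        mul_le_mul_of_nonneg_right h2 (by positivity)
    _ = _ := by ring

/-- Cauchy-Schwarz over at most `m²` pairs. It turns the Hilbert-Schmidt bound on the transfer error
into a sum over the matrix entries, at the cost of a factor `m`. -/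
theorem sum_sqrt_le {m : ℕ} {κ : ℝ} (hκ : 0 ≤ κ) (hα : Fintype.card α ≤ m)
    (hβ : Fintype.card β ≤ m) (f : α → β → ℝ) (hf : ∀ a b, 0 ≤ f a b)
    (h : ∑ a, ∑ b, f a b ≤ κ ^ 2) : ∑ a, ∑ b, √(f a b) ≤ m * κ := by
  rw [← Fintype.sum_prod_type'] at h ⊢
  refine le_of_sq_le_sq ?_ (by positivity)
  have h1 := sq_sum_le_card_mul_sum_sq (s := (Finset.univ : Finset (α × β)))
    (f := fun p => √(f p.1 p.2))
  refine h1.trans ?_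
  rw [Finset.sum_congr rfl fun p _ => Real.sq_sqrt (hf p.1 p.2), mul_pow, Finset.card_univ,
    Fintype.card_prod]
  have h2 : ((Fintype.card α * Fintype.card β : ℕ) : ℝ) ≤ (m : ℝ) ^ 2 := by
    have := Nat.mul_le_mul hα hβ
    rw [sq]
    exact_mod_cast this
  exact mul_le_mul h2 h (Finset.sum_nonneg fun p _ => hf _ _) (by positivity)

variable {m k : ℕ} {c κ : ℝ} {ρ : ChainOp d N}

/-- The superoperator that replaces the operators on the sites right of `k` by the error that a
perturbation `D` of the transfer map at the site `k + 1` causes. -/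
theorem exists_correction (hρ : IsState ρ) (hk : k < N) (hα : Fintype.card α ≤ m)
    (hβ : Fintype.card β ≤ m) (hc : 0 ≤ c) (hκ : 0 ≤ κ)
    (z : β → ChainOp d N) (hz : ∀ b, ‖z b‖ ≤ 1) (x : α → ChainOp d N) (hx : ∀ a, ‖x a‖ ≤ c)
    (D : Op d (block N (k + 1) (k + 1)) →ₗ[ℂ] Matrix α β ℂ)
    (hD : ∑ e, frobSq (D (unit e)) ≤ κ ^ 2) :
    ∃ Φ : ChainOp d N →ₗ[ℂ] ChainOp d N, (∀ W, ‖Φ W‖ ≤ m * √d * c * κ * ‖W‖) ∧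
      ∀ Y ∈ supported d (block N 1 k), ∀ A, ∀ X ∈ supported d (block N (k + 2) N),
        Φ (Y * embed (block N (k + 1) (k + 1)) A * X)
          = Y * ∑ a, (∑ b, D A a b * expect ρ (z b * X)) • x a := by
  -- `S b` removes the sites right of `k + 1` with the functional `X ↦ ω(z_b X)`, which is
  -- contractive because `‖z_b‖ ≤ 1`.
  have hS : ∀ b, ∃ S : ChainOp d N →ₗ[ℂ] ChainOp d N, (∀ W, ‖S W‖ ≤ 1 * ‖W‖) ∧
      ∀ Y ∈ supported d (block N (k + 2) N)ᶜ, ∀ X,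
        S (Y * embed (block N (k + 2) N) X) = expect ρ (z b * embed (block N (k + 2) N) X) • Y := by
    intro b
    refine exists_slice _ ((expect ρ).comp
      ((LinearMap.mulLeft ℂ (z b)).comp (embedLin (block N (k + 2) N)))) zero_le_one fun X => ?_
    change ‖expect ρ (z b * embed _ X)‖ ≤ _
    refine (norm_expect_le hρ _).trans ((norm_mul_le _ _).trans ?_)
    exact mul_le_mul (hz b) (norm_embed_le _ _) (norm_nonneg _) zero_le_one
  choose S hSn hS using hS
  let entry : α → β → Op d (block N (k + 1) (k + 1)) →ₗ[ℂ] ℂ := fun a b =>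
    { toFun := fun A => D A a b
      map_add' := fun A B => by simp
      map_smul' := fun s A => by simp }
  -- `T a b` then removes the site `k + 1` with the functional `A ↦ D(A)_ab`; what remains is `Y`,
  -- which gets multiplied by `x_a` on the right.
  have hT : ∀ a b, ∃ T : ChainOp d N →ₗ[ℂ] ChainOp d N,
      (∀ W, ‖T W‖ ≤ √d * √(∑ e, ‖D (unit e) a b‖ ^ 2) * ‖W‖) ∧
      ∀ Y ∈ supported d (block N (k + 1) (k + 1))ᶜ, ∀ A,
        T (Y * embed (block N (k + 1) (k + 1)) A) = D A a b • Y := by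
    intro a b
    refine exists_slice _ (entry a b) (by positivity) fun A => ?_
    have h := norm_functional_le (entry a b) A
    rw [card_block_singleton hk, pow_one] at h
    exact h
  choose T hTn hT using hT
  refine ⟨∑ a, ∑ b, (LinearMap.mulRight ℂ (x a)).comp ((T a b).comp (S b)), fun W => ?_, ?_⟩
  · simp only [LinearMap.sum_apply, LinearMap.comp_apply, LinearMap.mulRight_apply]
    have h1 : ∀ a b, ‖T a b (S b W) * x a‖
        ≤ √(∑ e, ‖D (unit e) a b‖ ^ 2) * (√d * c * ‖W‖) := by
      intro a b
      refine (norm_mul_le _ _).trans ?_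
      calc ‖T a b (S b W)‖ * ‖x a‖
          ≤ (√d * √(∑ e, ‖D (unit e) a b‖ ^ 2) * ‖W‖) * c := by
            refine mul_le_mul ((hTn a b _).trans ?_) (hx a) (norm_nonneg _) (by positivity)
            exact mul_le_mul_of_nonneg_left (by simpa using hSn b W) (by positivity)
        _ = _ := by ring
    calc ‖∑ a, ∑ b, T a b (S b W) * x a‖
        ≤ ∑ a, ∑ b, √(∑ e, ‖D (unit e) a b‖ ^ 2) * (√d * c * ‖W‖) :=
          (norm_sum_le _ _).trans (Finset.sum_le_sum fun a _ =>
            (norm_sum_le _ _).trans (Finset.sum_le_sum fun b _ => h1 a b))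
      _ = (∑ a, ∑ b, √(∑ e, ‖D (unit e) a b‖ ^ 2)) * (√d * c * ‖W‖) := by
          simp only [Finset.sum_mul]
      _ ≤ (m * κ) * (√d * c * ‖W‖) := by
          refine mul_le_mul_of_nonneg_right ?_ (by positivity)
          refine sum_sqrt_le hκ hα hβ _ (fun a b => by positivity) (le_trans (le_of_eq ?_) hD)
          unfold frobSq
          rw [Finset.sum_comm (s := (Finset.univ : Finset (OpIdx d (block N (k + 1) (k + 1)))))]
          exact Finset.sum_congr rfl fun a _ => Finset.sum_comm
      _ = _ := by ring
  · rintro Y hY A _ ⟨X, rfl⟩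
    change (∑ a, ∑ b, (LinearMap.mulRight ℂ (x a)).comp ((T a b).comp (S b)))
      (Y * embed _ A * embed _ X) = Y * ∑ a, (∑ b, D A a b * expect ρ (z b * embed _ X)) • x a
    have hYA : Y * embed (block N (k + 1) (k + 1)) A ∈ supported d (block N (k + 2) N)ᶜ :=
      mul_mem_supported (disjoint_block (Nat.lt_succ_self k)) (block_subset_compl (by omega))
        (block_subset_compl (by omega)) hY (embed_mem_supported _ A)
    have hY' : Y ∈ supported d (block N (k + 1) (k + 1))ᶜ :=
      supported_mono (block_subset_compl (by omega)) hY
    simp only [LinearMap.sum_apply, LinearMap.comp_apply, LinearMap.mulRight_apply,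
      hS _ _ hYA, map_smul, hT _ _ _ hY', Matrix.mul_sum, Finset.sum_smul]
    refine Finset.sum_congr rfl fun a _ => Finset.sum_congr rfl fun b _ => ?_
    rw [smul_smul, Matrix.mul_smul, mul_comm (D A a b)]

/-- One step of the hybrid argument: replacing the transfer map `K` of the state `ρ` at the site
`k + 1` by `K'` amounts to a small perturbation of the operator on the chain. -/
theorem exists_step (hρ : IsState ρ) (hk : k < N) (hα : Fintype.card α ≤ m)
    (hβ : Fintype.card β ≤ m) (hc : 0 ≤ c) (hκ : 0 ≤ κ) [DecidableEq α]
    (y : α → ChainOp d N) (x : α → ChainOp d N) (hx : ∀ a, ‖x a‖ ≤ c)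
    (hxs : ∀ a, x a ∈ supported d (block N (k + 1) N))
    (hyx : ∀ a a', expect ρ (y a * x a') = if a = a' then 1 else 0)
    (z : β → ChainOp d N) (hz : ∀ b, ‖z b‖ ≤ 1)
    (K K' : Op d (block N (k + 1) (k + 1)) →ₗ[ℂ] Matrix α β ℂ)
    (hK : ∀ A a, ∀ V ∈ supported d (block N (k + 2) N),
      expect ρ (y a * embed (block N (k + 1) (k + 1)) A * V) = ∑ b, K A a b * expect ρ (z b * V))
    (hKK' : ∑ e, frobSq (K' (unit e) - K (unit e)) ≤ κ ^ 2) :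
    ∃ Φ : ChainOp d N →ₗ[ℂ] ChainOp d N, (∀ W, ‖Φ W‖ ≤ m * √d * c * κ * ‖W‖) ∧
      ∀ Y ∈ supported d (block N 1 k), ∀ A, ∀ V ∈ supported d (block N (k + 2) N),
        ∃ V' ∈ supported d (block N (k + 1) N),
          Y * embed (block N (k + 1) (k + 1)) A * V
            + Φ (Y * embed (block N (k + 1) (k + 1)) A * V) = Y * V' ∧
          ∀ a, expect ρ (y a * V') = ∑ b, K' A a b * expect ρ (z b * V) := by
  obtain ⟨Φ, hΦn, hΦ⟩ := exists_correction hρ hk hα hβ hc hκ z hz x hx (K' - K) hKK'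
  refine ⟨Φ, hΦn, fun Y hY A V hV => ?_⟩
  -- The added term changes the coefficient `ω(y_a · )` of `A V` by the entry for `K' - K`, because
  -- `ω(y_a x_a') = δ_aa'`; the coefficients produced by `K` thus become those produced by `K'`.
  refine ⟨embed (block N (k + 1) (k + 1)) A * V
    + ∑ a, (∑ b, (K' - K) A a b * expect ρ (z b * V)) • x a, ?_, ?_, fun a => ?_⟩
  · refine Submodule.add_mem _ ?_ (Submodule.sum_mem _ fun a _ => Submodule.smul_mem _ _ (hxs a))
    exact mul_mem_supported (disjoint_block (by omega)) (block_subset_block (by omega) (by omega))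
      (block_subset_block (by omega) (by omega)) (embed_mem_supported _ A) hV
  · rw [hΦ Y hY A V hV, Matrix.mul_add, Matrix.mul_assoc]
  · rw [Matrix.mul_add, map_add, ← Matrix.mul_assoc, hK A a V hV, Matrix.mul_sum, map_sum]
    simp only [Matrix.mul_smul, map_smul, hyx, smul_eq_mul, mul_ite, mul_one, mul_zero]
    rw [Finset.sum_ite_eq, if_pos (Finset.mem_univ a), ← Finset.sum_add_distrib]
    refine Finset.sum_congr rfl fun b _ => ?_
    rw [LinearMap.sub_apply, Matrix.sub_apply]
    ring

end Corrections

/-! ### Orthogonality from the rank condition -/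

section Kernel

/-- The identity `C F G = 1` forces `F G` to have rank `k`, so `F G` and `F` have the same range. On
that range `C` is injective, since `C F G w = w`. -/
theorem mulVec_eq_zero_of_rank_eq {p q k : Type} [Fintype p] [Fintype q] [Fintype k]
    [DecidableEq k] {F : Matrix p q ℂ} {C : Matrix k p ℂ} {G : Matrix q k ℂ}
    (hCFG : C * F * G = 1) (hF : F.rank = Fintype.card k) {v : q → ℂ}
    (hv : (C * F) *ᵥ v = 0) : F *ᵥ v = 0 := by
  classical
  have hle : LinearMap.range (F * G).mulVecLin ≤ LinearMap.range F.mulVecLin := by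
    rw [mulVecLin_mul]
    exact LinearMap.range_comp_le_range _ _
  have hrank : F.rank ≤ (F * G).rank := by
    rw [hF, ← rank_one (R := ℂ) (n := k), ← hCFG, Matrix.mul_assoc]
    exact rank_mul_le_right _ _
  have heq := Submodule.eq_of_le_of_finrank_le hle hrank
  have hmem : F.mulVecLin v ∈ LinearMap.range (F * G).mulVecLin := heq ▸ ⟨v, rfl⟩
  obtain ⟨w, hw⟩ := hmem
  rw [mulVecLin_apply, mulVecLin_apply] at hw
  have h1 : w = 0 := by
    have h2 := congrArg (C *ᵥ ·) hw
    simp only [mulVec_mulVec] at h2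
    rw [← Matrix.mul_assoc, hCFG, one_mulVec, hv] at h2
    exact h2
  rw [← hw, h1, mulVec_zero]

variable {d N : ℕ}

/-- If the pairing between operators `z` on `I` and `x` on `J` is a perfect pairing of dimension
the rank of the whole correlation map, then the operators on `J` that are orthogonal to all `z`
are orthogonal to all operators on `I`. -/
theorem expect_mul_eq_zero {I J : Finset (Fin N)} (hIJ : Disjoint I J) (ρ : ChainOp d N)
    {κ : Type} [Fintype κ] [DecidableEq κ]
    (hrank : (omegaMap (marginal ρ (I ∪ J))).rank = Fintype.card κ)
    {z x : κ → ChainOp d N} (hz : ∀ b, z b ∈ supported d I) (hx : ∀ b, x b ∈ supported d J)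
    (hzx : ∀ a b, expect ρ (z a * x b) = if a = b then 1 else 0)
    {X : ChainOp d N} (hX : X ∈ supported d J) (hzX : ∀ b, expect ρ (z b * X) = 0)
    {Y : ChainOp d N} (hY : Y ∈ supported d I) : expect ρ (Y * X) = 0 := by
  choose z' hz' using hz
  choose x' hx' using hx
  obtain ⟨X', rfl⟩ := hX
  obtain ⟨Y', rfl⟩ := hY
  let C : Matrix κ (OpIdx d I) ℂ := of fun b p => z' b p.1 p.2
  let G : Matrix (OpIdx d J) κ ℂ := of fun q b => x' b q.1 q.2
  have hC : ∀ b, rowOp C b = z b := hz'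
  have hG : ∀ b, colOp G b = x b := hx'
  have hCFG : C * omegaMap (marginal ρ (I ∪ J)) * G = 1 := by
    ext a b
    rw [← expect_rowOp_mul_colOp hIJ, hC, hG, hzx, Matrix.one_apply]
  let R : Matrix (OpIdx d J) Unit ℂ := of fun q _ => X' q.1 q.2
  let L : Matrix Unit (OpIdx d I) ℂ := of fun _ p => Y' p.1 p.2
  have hR : colOp R () = embedLin J X' := rfl
  have hL : rowOp L () = embedLin I Y' := rfl
  have h0 := mulVec_eq_zero_of_rank_eq hCFG hrank (v := fun q => R q ()) (by
    ext b
    have h := expect_rowOp_mul_colOp hIJ ρ C R b ()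
    rw [hC, hR, hzX] at h
    exact h.symm)
  rw [← hR, ← hL, expect_rowOp_mul_colOp hIJ, Matrix.mul_assoc, Matrix.mul_apply]
  refine Finset.sum_eq_zero fun p _ => ?_
  have h1 : (omegaMap (marginal ρ (I ∪ J)) * R) p () = 0 := congrFun h0 p
  rw [h1, mul_zero]

end Kernel

/-! ### Bounds at a single cut -/

section Cut

variable {d N l r m : ℕ} {ρ : ChainOp d N} {ε η s : ℝ}

/-- The entry of `Ω` at the pair of identities is `ω(1) = 1`, even when the windows are empty. -/
theorem rank_omega_ne_zero (hρ : IsState ρ) (j : ℕ) : ((marginals l r ρ).omega j).rank ≠ 0 := by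
  intro h0
  have hzero : (marginals l r ρ).omega j = 0 := by
    rw [rank_eq_finrank_range_toEuclideanLin, Submodule.finrank_eq_zero,
      LinearMap.range_eq_bot] at h0
    exact (Matrix.toEuclideanLin.map_eq_zero_iff).1 h0
  have h1 : expect ρ (embed (leftWin N l j) 1 * embed (rightWin N r j) 1) = 0 := by
    have h2 := expect_rowOp_mul_colOp (disjoint_leftWin_rightWin N l r j) ρ
      (of fun (_ : Unit) p => (1 : Op d (leftWin N l j)) p.1 p.2)
      (of fun q (_ : Unit) => (1 : Op d (rightWin N r j)) q.1 q.2) () ()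
    rw [show omegaMap (marginal ρ (leftWin N l j ∪ rightWin N r j)) = 0 from hzero,
      Matrix.mul_zero, Matrix.zero_mul] at h2
    exact h2
  rw [embed_one, embed_one, Matrix.mul_one, expect_one hρ] at h1
  exact one_ne_zero h1

theorem sigmaCut_pos (hρ : IsState ρ) (j : ℕ) : 0 < sigmaCut l r ρ j :=
  sigmaMin_pos (rank_omega_ne_zero hρ j)

theorem sigmaCut_le_one (hρ : IsState ρ) (j : ℕ) : sigmaCut l r ρ j ≤ 1 := by
  refine (sigmaMin_le_opNorm (rank_omega_ne_zero hρ j)).trans ((opNorm_le_sqrt_frobSq _).trans ?_)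
  rw [Real.sqrt_le_one]
  change frobSq (omegaMap (marginal ρ _)) ≤ 1
  rw [frobSq_omegaMap (disjoint_leftWin_rightWin N l r j)]
  exact frobSq_le_one_of_isState (isState_marginal hρ _)

theorem norm_omega_sub_le {E : LocalData d N l r} {j : ℕ}
    (h : hsNorm (E.cut j - (marginals l r ρ).cut j) ≤ ε) :
    ‖E.omega j - (marginals l r ρ).omega j‖ ≤ ε := by
  refine (opNorm_le_sqrt_frobSq _).trans ?_
  change √(frobSq (omegaMap (E.cut j) - omegaMap ((marginals l r ρ).cut j))) ≤ ε
  rw [← omegaMap_sub, frobSq_omegaMap (disjoint_leftWin_rightWin N l r j)]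
  exact h

theorem sum_frobSq_omegaAt_sub_le {E : LocalData d N l r} {k : ℕ}
    (h : hsNorm (E.site k - (marginals l r ρ).site k) ≤ ε) :
    ∑ e, frobSq (E.omegaAt k (unit e) - (marginals l r ρ).omegaAt k (unit e)) ≤ ε ^ 2 := by
  have h1 : ∀ e, E.omegaAt k (unit e) - (marginals l r ρ).omegaAt k (unit e)
      = omegaMapAt (E.site k - (marginals l r ρ).site k) (unit e) :=
    fun e => (omegaMapAt_sub _ _ _).symm
  simp only [h1]
  rw [sum_frobSq_omegaMapAt (disjoint_leftWin_site N l k) (disjoint_leftWin_union_site N l r k),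
    ← hsNorm_sq]
  exact pow_le_pow_left₀ (Real.sqrt_nonneg _) h 2

theorem sum_frobSq_omegaAt_le (hρ : IsState ρ) (k : ℕ) :
    ∑ e, frobSq ((marginals l r ρ).omegaAt k (unit e)) ≤ 1 := by
  change ∑ e, frobSq (omegaMapAt (marginal ρ _) (unit e)) ≤ 1
  rw [sum_frobSq_omegaMapAt (disjoint_leftWin_site N l k) (disjoint_leftWin_union_site N l r k)]
  exact frobSq_le_one_of_isState (isState_marginal hρ _)

theorem frame_isometry (svd : SVDRoutine d N l r) (η : ℝ) (E : LocalData d N l r) (j : ℕ) :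
    (frame svd η E j)ᴴ * frame svd η E j = 1 :=
  SVD.truncatedU_isometry _ η

theorem norm_frame_conjTranspose_le (svd : SVDRoutine d N l r) (η : ℝ) (E : LocalData d N l r)
    (j : ℕ) : ‖(frame svd η E j)ᴴ‖ ≤ 1 := by
  rw [l2_opNorm_conjTranspose]
  exact opNorm_le_one_of_isometry (frame_isometry svd η E j)

/-- What the reconstruction at the cut `j` needs: the estimated pseudo-inverse and a right inverse
`R` of the true map are bounded, and the operators on the right of the cut that are orthogonal to
the frame are orthogonal to everything on the left. -/
structure CutBound (ρ : ChainOp d N) (svd : SVDRoutine d N l r) (η : ℝ) (E : LocalData d N l r)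
    (m : ℕ) (s : ℝ) (j : ℕ) (R : Matrix (OpIdx d (rightWin N r j)) (Kept svd η E j) ℂ) :
    Prop where
  card_le : Fintype.card (Kept svd η E j) ≤ m
  omega_framePinv : (frame svd η E j)ᴴ * E.omega j * framePinv svd η E j = 1
  norm_framePinv_le : ‖framePinv svd η E j‖ ≤ 2 / s
  omega_right : (frame svd η E j)ᴴ * (marginals l r ρ).omega j * R = 1
  norm_right_le : ‖R‖ ≤ 2 / s
  orthogonal : ∀ X ∈ supported d (block N (j + 1) N),
    (∀ b, expect ρ (rowOp (frame svd η E j)ᴴ b * X) = 0) →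
    ∀ Y ∈ supported d (block N 1 j), expect ρ (Y * X) = 0

/-- The spectral bounds come from the perturbation of the singular value decomposition of the local
map. Orthogonality against the whole left part uses that the local rank equals the rank of the map
of the full chain, so that a perfect pairing found inside the windows already exhausts all
correlations across the cut. -/
theorem exists_cutBound (hfc : IsFinitelyCorrelated l r m ρ)
    (svd : SVDRoutine d N l r) {E : LocalData d N l r} {j : ℕ} (hj : j ≤ N) (hε : 0 < ε)
    (hs : 0 < s) (hsσ : s ≤ sigmaCut l r ρ j) (hεη : 2 * ε ≤ η)
    (hησ : η ≤ sigmaCut l r ρ j / 2) (hE : hsNorm (E.cut j - (marginals l r ρ).cut j) ≤ ε) :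
    ∃ R, CutBound ρ svd η E m s j R := by
  obtain ⟨hcard, hP, hPn, R, hR, hRn⟩ := (svd j (E.omega j)).truncated_properties hε
    (norm_omega_sub_le hE) hεη hησ
  have h2s : 2 / sigmaMin ((marginals l r ρ).omega j) ≤ 2 / s :=
    div_le_div_of_nonneg_left zero_le_two hs hsσ
  refine ⟨R, hcard.trans_le (hfc j hj).2, hP, hPn.trans h2s, hR, hRn.trans h2s, ?_⟩
  intro X hX hzX Y hY
  refine expect_mul_eq_zero (disjoint_block (Nat.lt_succ_self j)) ρ
    ((hfc j hj).1.trans hcard.symm) (z := rowOp (frame svd η E j)ᴴ) (x := colOp R)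
    (fun b => supported_mono (block_subset_block (by omega) (by omega)) (rowOp_mem_supported _ b))
    (fun b => supported_mono (block_subset_block (by omega) (by omega)) (colOp_mem_supported _ b))
    (fun a b => ?_) hX hzX hY
  rw [expect_rowOp_mul_colOp (disjoint_leftWin_rightWin N l r j), ← Matrix.one_apply, ← hR]
  rfl

end Cut

/-! ### True and estimated transfer maps -/

section Transfer

variable {d N l r m : ℕ} {ρ : ChainOp d N} {ε η s : ℝ} {svd : SVDRoutine d N l r}
  {E : LocalData d N l r} {k : ℕ}
  {R : Matrix (OpIdx d (rightWin N r (k + 1))) (Kept svd η E (k + 1)) ℂ}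
  {α : Type}

/-- `A ↦ f Ω_A R` as a linear map. -/
def transferLin (E : LocalData d N l r) (k : ℕ) {α β : Type}
    (f : Matrix α (OpIdx d (leftWin N l k)) ℂ)
    (R : Matrix (OpIdx d (rightWin N r (k + 1))) β ℂ) :
    Op d (block N (k + 1) (k + 1)) →ₗ[ℂ] Matrix α β ℂ where
  toFun A := f * E.omegaAt k A * R
  map_add' A B := by
    have h : E.omegaAt k (A + B) = E.omegaAt k A + E.omegaAt k B :=
      (omegaMapAtLin (E.site k)).map_add A B
    rw [h, Matrix.mul_add, Matrix.add_mul]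
  map_smul' c A := by
    have h : E.omegaAt k (c • A) = c • E.omegaAt k A :=
      (omegaMapAtLin (E.site k)).map_smul c A
    rw [h, Matrix.mul_smul, Matrix.smul_mul, RingHom.id_apply]

theorem transferLin_apply (E : LocalData d N l r) (k : ℕ) {α β : Type}
    (f : Matrix α (OpIdx d (leftWin N l k)) ℂ) (R : Matrix (OpIdx d (rightWin N r (k + 1))) β ℂ)
    (A : Op d (block N (k + 1) (k + 1))) :
    transferLin E k f R A = f * E.omegaAt k A * R := rfl

theorem expect_rowOp_mul_embed_mul_colOp_eq_transferLin (ρ : ChainOp d N) (k : ℕ) {α β : Type}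
    (f : Matrix α (OpIdx d (leftWin N l k)) ℂ) (R : Matrix (OpIdx d (rightWin N r (k + 1))) β ℂ)
    (A : Op d (block N (k + 1) (k + 1))) (a : α) (b : β) :
    expect ρ (rowOp f a * embed _ A * colOp R b)
      = transferLin (marginals l r ρ) k f R A a b :=
  expect_rowOp_mul_embed_mul_colOp (disjoint_leftWin_site N l k)
    (disjoint_leftWin_union_site N l r k) ρ f A R a b

theorem rowOp_mul_embed_mem_supported (f : Matrix α (OpIdx d (leftWin N l k)) ℂ) (a : α)
    (A : Op d (block N (k + 1) (k + 1))) :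
    rowOp f a * embed _ A ∈ supported d (block N 1 (k + 1)) :=
  mul_mem_supported (disjoint_leftWin_site N l k) (block_subset_block (by omega) (by omega))
    (block_subset_block (by omega) (by omega)) (rowOp_mem_supported f a) (embed_mem_supported _ A)

/-- The transfer maps of `ρ` propagate its correlations. -/
theorem CutBound.expect_transfer (hR : CutBound ρ svd η E m s (k + 1) R)
    (f : Matrix α (OpIdx d (leftWin N l k)) ℂ) (A : Op d (block N (k + 1) (k + 1))) (a : α)
    {V : ChainOp d N} (hV : V ∈ supported d (block N (k + 2) N)) :
    expect ρ (rowOp f a * embed _ A * V) = ∑ b, transferLin (marginals l r ρ) k f R A a b *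
      expect ρ (rowOp (frame svd η E (k + 1))ᴴ b * V) := by
  set z := rowOp (frame svd η E (k + 1))ᴴ with hz
  have hzR : ∀ b b', expect ρ (z b * colOp R b') = if b = b' then 1 else 0 := by
    intro b b'
    rw [hz, expect_rowOp_mul_colOp (disjoint_leftWin_rightWin N l r (k + 1)), ← Matrix.one_apply,
      ← hR.omega_right]
    rfl
  -- Subtracting its expansion in the dual operators makes `V` orthogonal to every `z_b`, hence to
  -- everything on the left of the cut, in particular to `rowOp f a * embed _ A`.
  have hmem : V - ∑ b, expect ρ (z b * V) • colOp R b ∈ supported d (block N (k + 2) N) :=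
    Submodule.sub_mem _ hV (Submodule.sum_mem _ fun b _ => Submodule.smul_mem _ _
      (supported_mono (block_subset_block (by omega) (by omega)) (colOp_mem_supported R b)))
  have h0 := hR.orthogonal _ hmem (fun b => by
    rw [Matrix.mul_sub, map_sub, Matrix.mul_sum, map_sum]
    simp [← hz, hzR]) _ (rowOp_mul_embed_mem_supported f a A)
  rw [Matrix.mul_sub, map_sub, sub_eq_zero, Matrix.mul_sum, map_sum] at h0
  rw [h0]
  refine Finset.sum_congr rfl fun b _ => ?_
  rw [Matrix.mul_smul, map_smul, expect_rowOp_mul_embed_mul_colOp_eq_transferLin, smul_eq_mul,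
    mul_comm]

/-- The propagation identity applied to the columns of `Q`: the true `Ω_A` factors through the
`m_j`-dimensional frame, so an arbitrary `Q` can be exchanged for `R`. -/
theorem CutBound.transfer_factor (hR : CutBound ρ svd η E m s (k + 1) R) {β : Type}
    (f : Matrix α (OpIdx d (leftWin N l k)) ℂ) (A : Op d (block N (k + 1) (k + 1)))
    (Q : Matrix (OpIdx d (rightWin N r (k + 1))) β ℂ) :
    f * (marginals l r ρ).omegaAt k A * Q = f * (marginals l r ρ).omegaAt k A * R *
      ((frame svd η E (k + 1))ᴴ * (marginals l r ρ).omega (k + 1) * Q) := by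
  ext a b
  have h := hR.expect_transfer f A a (V := colOp Q b)
    (supported_mono (block_subset_block (by omega) (by omega)) (colOp_mem_supported Q b))
  rw [expect_rowOp_mul_embed_mul_colOp_eq_transferLin] at h
  rw [← transferLin_apply, h, Matrix.mul_apply]
  refine Finset.sum_congr rfl fun b' _ => ?_
  rw [expect_rowOp_mul_colOp (disjoint_leftWin_rightWin N l r (k + 1)), transferLin_apply]
  rfl

/-- The error splits into the error of `Ω_A`, seen through the pseudo-inverse, and the mismatch
between the pseudo-inverse and `R`. Factoring through the frame makes the second linear in the error
of `Ω` and avoids comparing pseudo-inverses of two different matrices. -/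
theorem CutBound.sum_frobSq_transfer_sub_le [Fintype α] [DecidableEq α]
    (hR : CutBound ρ svd η E m s (k + 1) R) (hρ : IsState ρ) (hε : 0 < ε) (hs : 0 < s)
    (hs1 : s ≤ 1) (hcut : hsNorm (E.cut (k + 1) - (marginals l r ρ).cut (k + 1)) ≤ ε)
    (hsite : hsNorm (E.site k - (marginals l r ρ).site k) ≤ ε)
    {f : Matrix α (OpIdx d (leftWin N l k)) ℂ} (hf : ‖f‖ ≤ 1) :
    ∑ e, frobSq (transferLin E k f (framePinv svd η E (k + 1)) (unit e)
      - transferLin (marginals l r ρ) k f R (unit e)) ≤ (7 * ε / s ^ 2) ^ 2 := by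
  set P := framePinv svd η E (k + 1) with hP
  set U := (frame svd η E (k + 1))ᴴ with hU
  set M := marginals l r ρ with hM
  set Q := R * (U * (M.omega (k + 1) - E.omega (k + 1))) * P with hQ
  have hQn : ‖Q‖ ≤ 4 * ε / s ^ 2 := by
    have h1 : ‖U * (M.omega (k + 1) - E.omega (k + 1))‖ ≤ ε := by
      refine (l2_opNorm_mul _ _).trans ?_
      rw [norm_sub_rev]
      exact (mul_le_of_le_one_left (norm_nonneg _)
        (norm_frame_conjTranspose_le svd η E (k + 1))).trans (norm_omega_sub_le hcut)
    calc ‖Q‖ ≤ ‖R * (U * (M.omega (k + 1) - E.omega (k + 1)))‖ * ‖P‖ := l2_opNorm_mul _ _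
      _ ≤ (2 / s * ε) * (2 / s) := by
          refine mul_le_mul ((l2_opNorm_mul _ _).trans ?_) hR.norm_framePinv_le (norm_nonneg _)
            (by positivity)
          exact mul_le_mul hR.norm_right_le h1 (norm_nonneg _) (by positivity)
      _ = 4 * ε / s ^ 2 := by field_simp; norm_num
  -- From `U Ω̂ P = 1` and `f Ω_A P = f Ω_A R (U Ω P)` follows `f Ω_A P - f Ω_A R = f Ω_A R U (Ω -
  -- Ω̂) P = f Ω_A Q`.
  have hdecomp : ∀ A, transferLin E k f P A - transferLin M k f R A
      = f * ((E.omegaAt k A - M.omegaAt k A) * P) + f * (M.omegaAt k A * Q) := by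
    intro A
    have h1 := hR.transfer_factor f A P
    have h2 : f * (M.omegaAt k A * Q) = f * M.omegaAt k A * P - f * M.omegaAt k A * R := by
      rw [h1, hQ]
      have h3 := hR.omega_framePinv
      simp only [Matrix.mul_sub, Matrix.sub_mul, Matrix.mul_assoc] at h3 ⊢
      rw [h3, Matrix.mul_one]
    rw [h2, transferLin_apply, transferLin_apply, Matrix.sub_mul, Matrix.mul_sub]
    simp only [Matrix.mul_assoc]
    abel
  have hleft : ∀ {β : Type} [Fintype β] (X : Matrix (OpIdx d (leftWin N l k)) β ℂ),
      frobSq (f * X) ≤ frobSq X := by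
    intro β _ X
    exact (frobSq_mul_le_left _ _).trans
      (mul_le_of_le_one_left (frobSq_nonneg _) (pow_le_one₀ (norm_nonneg _) hf))
  have hterm : ∀ e, frobSq (transferLin E k f P (unit e) - transferLin M k f R (unit e))
      ≤ frobSq (E.omegaAt k (unit e) - M.omegaAt k (unit e)) * (8 / s ^ 2)
        + frobSq (M.omegaAt k (unit e)) * (32 * ε ^ 2 / s ^ 4) := by
    intro e
    rw [hdecomp]
    refine (frobSq_add_le _ _).trans ?_
    have h1 := (hleft ((E.omegaAt k (unit e) - M.omegaAt k (unit e)) * P)).trans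
      (frobSq_mul_le_right _ _)
    have h2 := (hleft (M.omegaAt k (unit e) * Q)).trans (frobSq_mul_le_right _ _)
    have h3 : ‖P‖ ^ 2 ≤ 4 / s ^ 2 :=
      (pow_le_pow_left₀ (norm_nonneg _) hR.norm_framePinv_le 2).trans_eq (by
        rw [div_pow]; norm_num)
    have h4 : ‖Q‖ ^ 2 ≤ 16 * ε ^ 2 / s ^ 4 :=
      (pow_le_pow_left₀ (norm_nonneg _) hQn 2).trans_eq (by
        rw [div_pow, mul_pow, ← pow_mul]; norm_num)
    have h5 := h1.trans (mul_le_mul_of_nonneg_left h3 (frobSq_nonneg _))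
    have h6 := h2.trans (mul_le_mul_of_nonneg_left h4 (frobSq_nonneg _))
    calc _ ≤ 2 * (frobSq (E.omegaAt k (unit e) - M.omegaAt k (unit e)) * (4 / s ^ 2)
          + frobSq (M.omegaAt k (unit e)) * (16 * ε ^ 2 / s ^ 4)) := by linarith
      _ = _ := by ring
  refine (Finset.sum_le_sum fun e _ => hterm e).trans ?_
  rw [Finset.sum_add_distrib, ← Finset.sum_mul, ← Finset.sum_mul]
  have h7 := mul_le_mul_of_nonneg_right (sum_frobSq_omegaAt_sub_le hsite)
    (show (0 : ℝ) ≤ 8 / s ^ 2 by positivity)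
  have h8 := mul_le_mul_of_nonneg_right (sum_frobSq_omegaAt_le (l := l) (r := r) hρ k)
    (show (0 : ℝ) ≤ 32 * ε ^ 2 / s ^ 4 by positivity)
  have h9 : ε ^ 2 * (8 / s ^ 2) ≤ 8 * ε ^ 2 / s ^ 4 := by
    rw [mul_div_assoc', mul_comm]
    refine div_le_div_of_nonneg_left (by positivity) (by positivity) ?_
    exact pow_le_pow_of_le_one hs.le hs1 (by norm_num)
  -- The two contributions add up to at most `(8 + 32) ε² / s⁴`, and `40 ≤ 49 = 7²`.
  have h10 : (7 * ε / s ^ 2) ^ 2 = 8 * ε ^ 2 / s ^ 4 + 1 * (32 * ε ^ 2 / s ^ 4)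
      + 9 * ε ^ 2 / s ^ 4 := by ring
  have h11 : 0 ≤ 9 * ε ^ 2 / s ^ 4 := by positivity
  linarith

/-- At the last site there is no pseudo-inverse and the error is at most `ε`; the weaker bound only
makes it match the other sites. -/
theorem sum_frobSq_transfer_sub_le_of_last [Fintype α] [DecidableEq α]
    (hsite : hsNorm (E.site k - (marginals l r ρ).site k) ≤ ε) (hε : 0 < ε) (hs : 0 < s)
    (hs1 : s ≤ 1) {f : Matrix α (OpIdx d (leftWin N l k)) ℂ} (hf : ‖f‖ ≤ 1) :
    ∑ e, frobSq (transferLin E k f (1 : Matrix _ (OpIdx d (rightWin N r (k + 1))) ℂ) (unit e)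
      - transferLin (marginals l r ρ) k f (1 : Matrix _ (OpIdx d (rightWin N r (k + 1))) ℂ)
        (unit e)) ≤ (7 * ε / s ^ 2) ^ 2 := by
  have h1 : ε ^ 2 ≤ (7 * ε / s ^ 2) ^ 2 := by
    refine pow_le_pow_left₀ hε.le ?_ 2
    rw [le_div_iff₀ (by positivity)]
    have : s ^ 2 ≤ 1 := pow_le_one₀ hs.le hs1
    nlinarith
  refine le_trans (Finset.sum_le_sum fun e _ => ?_) ((sum_frobSq_omegaAt_sub_le hsite).trans h1)
  rw [transferLin_apply, transferLin_apply, Matrix.mul_one, Matrix.mul_one, ← Matrix.mul_sub]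
  exact (frobSq_mul_le_left _ _).trans
    (mul_le_of_le_one_left (frobSq_nonneg _) (pow_le_one₀ (norm_nonneg _) hf))

end Transfer

/-! ### Empty windows at the two ends of the chain -/

section EmptyBlocks

variable {d N : ℕ} {I : Finset (Fin N)}

theorem sum_opIdx_of_eq_empty (hI : I = ∅) {f : OpIdx d I → ℂ} {c : ℂ} (h : ∀ p, f p = c) :
    ∑ p, f p = c := by
  subst hI
  simp [h]

theorem card_opIdx_of_eq_empty (hI : I = ∅) : Fintype.card (OpIdx d I) = 1 := by
  subst hI
  simp

theorem rowOp_one_of_eq_empty (hI : I = ∅) (p : OpIdx d I) :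
    rowOp (1 : Matrix (OpIdx d I) (OpIdx d I) ℂ) p = 1 := by
  subst hI
  have h : opOf ((1 : Matrix (OpIdx d (∅ : Finset (Fin N))) (OpIdx d (∅ : Finset (Fin N))) ℂ) p)
      = 1 := by
    ext s t
    rw [Matrix.one_apply, if_pos (Subsingleton.elim s t)]
    change (1 : Matrix (OpIdx d (∅ : Finset (Fin N))) (OpIdx d (∅ : Finset (Fin N))) ℂ) p (s, t) = 1
    rw [Matrix.one_apply, if_pos (Subsingleton.elim p (s, t))]
  rw [rowOp, h, embed_one]

theorem colOp_one_of_eq_empty (hI : I = ∅) (p : OpIdx d I) :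
    colOp (1 : Matrix (OpIdx d I) (OpIdx d I) ℂ) p = 1 := by
  rw [← rowOp_one_of_eq_empty hI p]
  subst hI
  rw [colOp, rowOp]
  congr 2

theorem eq_smul_one_of_mem_supported_empty (hI : I = ∅) {V : ChainOp d N}
    (hV : V ∈ supported d I) : ∃ c : ℂ, V = c • 1 := by
  subst hI
  obtain ⟨v, rfl⟩ := hV
  refine ⟨v default default, ?_⟩
  have h : v = v default default • 1 := by
    ext s t
    rw [Subsingleton.elim s default, Subsingleton.elim t default]
    simp
  rw [h, map_smul]
  change _ • embed _ 1 = _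
  rw [embed_one]
  simp

theorem leftWin_zero (N l : ℕ) : leftWin N l 0 = ∅ := block_eq_empty (by omega)

theorem rightWin_self (N r : ℕ) : rightWin N r N = ∅ := block_eq_empty (by omega)

end EmptyBlocks

/-! ### Hybrid argument along the chain -/

section Hybrid

variable {d n l r m : ℕ} {ρ : ChainOp d (n + 2)} {ε η s : ℝ} {svd : SVDRoutine d (n + 2) l r}
  {E : LocalData d (n + 2) l r}

theorem chainProd_univ_split (X : Fin (n + 2) → Matrix (Fin d) (Fin d) ℂ) (k : ℕ) :
    chainProd X (block (n + 2) 1 (k + 1))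
      = chainProd X (block (n + 2) 1 k) * embed _ (prodOp X (block (n + 2) (k + 1) (k + 1))) := by
  rw [block_one_succ, chainProd_union X (disjoint_block (Nat.lt_succ_self k))]
  rfl

/-- Bounding the deviation from the identity, rather than the norm, makes the product of the factors
`id + Φ` accumulate to `(1 + Δ)^i - 1`. -/
theorem norm_perturbation_sub_le {a : Type} [Fintype a] [DecidableEq a]
    {Φ Ψ : Matrix a a ℂ →ₗ[ℂ] Matrix a a ℂ} {Δ : ℝ} (hΔ : 0 ≤ Δ) {i : ℕ}
    (hΦ : ∀ W, ‖Φ W‖ ≤ Δ * ‖W‖)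
    (hΨ : ∀ W, ‖Ψ W - W‖ ≤ ((1 + Δ) ^ i - 1) * ‖W‖) (W : Matrix a a ℂ) :
    ‖((LinearMap.id + Φ).comp Ψ) W - W‖ ≤ ((1 + Δ) ^ (i + 1) - 1) * ‖W‖ := by
  have h1 : ((LinearMap.id + Φ).comp Ψ) W - W = (Ψ W - W) + Φ (Ψ W) := by
    simp only [LinearMap.comp_apply, LinearMap.add_apply, LinearMap.id_apply]
    abel
  have h2 : ‖Ψ W‖ ≤ ‖Ψ W - W‖ + ‖W‖ := by
    have := norm_add_le (Ψ W - W) W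
    rwa [sub_add_cancel] at this
  rw [h1]
  calc ‖(Ψ W - W) + Φ (Ψ W)‖ ≤ ‖Ψ W - W‖ + Δ * (‖Ψ W - W‖ + ‖W‖) :=
        (norm_add_le _ _).trans
          (add_le_add le_rfl ((hΦ _).trans (mul_le_mul_of_nonneg_left h2 hΔ)))
    _ = (1 + Δ) * ‖Ψ W - W‖ + Δ * ‖W‖ := by ring
    _ ≤ (1 + Δ) * (((1 + Δ) ^ i - 1) * ‖W‖) + Δ * ‖W‖ :=
        add_le_add (mul_le_mul_of_nonneg_left (hΨ W) (by positivity)) le_rfl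
    _ = _ := by ring

/-- The bound for the perturbation that a single site contributes. -/
noncomputable def siteError (d m : ℕ) (s ε : ℝ) : ℝ := m * √d * (2 / s) * (7 * ε / s ^ 2)

theorem siteError_nonneg (hε : 0 < ε) (hs : 0 < s) : 0 ≤ siteError d m s ε := by
  unfold siteError; positivity

/-- Base case of the hybrid argument. The right window is empty, so its index set has one element,
and `z = 1` and `V = 1` serve as boundary condition. -/
theorem hybrid_last (hρ : IsState ρ) (hE : IsEstimate ρ ε E) (hε : 0 < ε) (hs : 0 < s)
    (hs1 : s ≤ 1) (hm : 1 ≤ m) (hcuts : ∀ j ≤ n, ∃ R, CutBound ρ svd η E m s (j + 1) R) :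
    ∃ Ψ : ChainOp d (n + 2) →ₗ[ℂ] ChainOp d (n + 2),
      (∀ W, ‖Ψ W - W‖ ≤ ((1 + siteError d m s ε) ^ 1 - 1) * ‖W‖) ∧
      ∀ X, ∃ V ∈ supported d (block (n + 2) (n + 2) (n + 2)),
        Ψ (chainProd X Finset.univ) = chainProd X (block (n + 2) 1 (n + 1)) * V ∧
        reconValue svd η E X = ∑ p, ∑ b, kProd svd η E X n p b *
          expect ρ (rowOp (frame svd η E (n + 1))ᴴ b * V) := by
  obtain ⟨R, hR⟩ := hcuts n le_rfl
  have hempty : rightWin (n + 2) r (n + 1 + 1) = ∅ := rightWin_self (n + 2) r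
  obtain ⟨Φ, hΦn, hΦ⟩ := exists_step (k := n + 1) (c := 2 / s) (κ := 7 * ε / s ^ 2) hρ
    (Nat.lt_succ_self _) hR.card_le ((card_opIdx_of_eq_empty hempty).trans_le hm) (by positivity)
    (by positivity) (rowOp (frame svd η E (n + 1))ᴴ) (colOp R)
    (fun a => (norm_colOp_le R a).trans hR.norm_right_le)
    (fun a => supported_mono (block_subset_block (by omega) (by omega)) (colOp_mem_supported R a))
    (fun a a' => by
      rw [expect_rowOp_mul_colOp (disjoint_leftWin_rightWin _ l r (n + 1)), ← Matrix.one_apply,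
        ← hR.omega_right]
      rfl)
    (fun _ => 1) (fun _ => opNorm_le_one_of_isometry (by simp))
    (transferLin (marginals l r ρ) (n + 1) (frame svd η E (n + 1))ᴴ 1)
    (transferLin E (n + 1) (frame svd η E (n + 1))ᴴ 1)
    (fun A a V hV => by
      obtain ⟨c, rfl⟩ := eq_smul_one_of_mem_supported_empty (block_eq_empty (by omega)) hV
      refine (sum_opIdx_of_eq_empty hempty fun q => ?_).symm
      rw [← expect_rowOp_mul_embed_mul_colOp_eq_transferLin, colOp_one_of_eq_empty hempty]
      simp only [Matrix.mul_smul, map_smul, Matrix.mul_one, expect_one hρ, smul_eq_mul]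
      ring)
    (sum_frobSq_transfer_sub_le_of_last (hE.2 (n + 1) (Nat.lt_succ_self _)) hε hs hs1
      (norm_frame_conjTranspose_le svd η E (n + 1)))
  refine ⟨LinearMap.id + Φ, fun W => ?_, fun X => ?_⟩
  · rw [LinearMap.add_apply, LinearMap.id_apply, add_sub_cancel_left, pow_one,
      add_sub_cancel_left]
    exact hΦn W
  · obtain ⟨V, hV, hYV, hval⟩ := hΦ (chainProd X (block (n + 2) 1 (n + 1)))
      (embed_mem_supported _ _) (prodOp X (block (n + 2) (n + 1 + 1) (n + 1 + 1))) 1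
      (one_mem_supported _)
    refine ⟨V, hV, ?_, ?_⟩
    · rw [Matrix.mul_one, ← chainProd_univ_split, block_one_self] at hYV
      exact hYV
    · simp only [hval, Matrix.mul_one, expect_one hρ, mul_one, transferLin_apply]
      unfold reconValue
      refine Finset.sum_congr rfl fun p _ => ?_
      simp only [Finset.mul_sum]
      rw [Finset.sum_comm]
      exact Finset.sum_congr rfl fun q _ => Matrix.mul_apply

theorem exists_mid_step (hρ : IsState ρ) (hE : IsEstimate ρ ε E) (hε : 0 < ε) (hs : 0 < s)
    (hs1 : s ≤ 1) {k : ℕ} (hk : k < n)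
    {R : Matrix (OpIdx d (rightWin (n + 2) r (k + 1))) (Kept svd η E (k + 1)) ℂ}
    {R' : Matrix (OpIdx d (rightWin (n + 2) r (k + 2))) (Kept svd η E (k + 2)) ℂ}
    (hR : CutBound ρ svd η E m s (k + 1) R) (hR' : CutBound ρ svd η E m s (k + 2) R') :
    ∃ Φ : ChainOp d (n + 2) →ₗ[ℂ] ChainOp d (n + 2),
      (∀ W, ‖Φ W‖ ≤ siteError d m s ε * ‖W‖) ∧
      ∀ Y ∈ supported d (block (n + 2) 1 (k + 1)), ∀ A,
        ∀ V ∈ supported d (block (n + 2) (k + 3) (n + 2)),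
        ∃ V' ∈ supported d (block (n + 2) (k + 2) (n + 2)),
          Y * embed (block (n + 2) (k + 2) (k + 2)) A * V
            + Φ (Y * embed (block (n + 2) (k + 2) (k + 2)) A * V) = Y * V' ∧
          ∀ a, expect ρ (rowOp (frame svd η E (k + 1))ᴴ a * V')
            = ∑ b, kMid svd η E k A a b * expect ρ (rowOp (frame svd η E (k + 2))ᴴ b * V) :=
  exists_step (k := k + 1) (c := 2 / s) (κ := 7 * ε / s ^ 2) hρ
    (by omega) hR.card_le hR'.card_le (by positivity)
    (by positivity) (rowOp (frame svd η E (k + 1))ᴴ) (colOp R)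
    (fun a => (norm_colOp_le R a).trans hR.norm_right_le)
    (fun a => supported_mono (block_subset_block (by omega) (by omega)) (colOp_mem_supported R a))
    (fun a a' => by
      rw [expect_rowOp_mul_colOp (disjoint_leftWin_rightWin _ l r (k + 1)), ← Matrix.one_apply,
        ← hR.omega_right]
      rfl)
    (rowOp (frame svd η E (k + 2))ᴴ)
    (fun b => (norm_rowOp_le _ b).trans (norm_frame_conjTranspose_le svd η E (k + 2)))
    (transferLin (marginals l r ρ) (k + 1) (frame svd η E (k + 1))ᴴ R')
    (transferLin E (k + 1) (frame svd η E (k + 1))ᴴ (framePinv svd η E (k + 2)))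
    (fun A a _ hV => hR'.expect_transfer _ A a hV)
    (hR'.sum_frobSq_transfer_sub_le hρ hε hs hs1 (hE.1 _ (by omega)) (hE.2 _ (by omega))
      (norm_frame_conjTranspose_le svd η E (k + 1)))

/-- Descending induction on the cut `k + 1`: once the last `i + 1` sites are corrected, the
remaining operator is still a product on the first `k + 1` sites, and the right factor `V` enters
`ω̂(X)` only through its frame coefficients. `Ψ` does not depend on `X`, which is what permits the
extension from product operators to all operators. -/
theorem hybrid_mid (hρ : IsState ρ) (hE : IsEstimate ρ ε E) (hε : 0 < ε) (hs : 0 < s)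
    (hs1 : s ≤ 1) (hm : 1 ≤ m) (hcuts : ∀ j ≤ n, ∃ R, CutBound ρ svd η E m s (j + 1) R)
    (i : ℕ) : ∀ k, k + i = n → ∃ Ψ : ChainOp d (n + 2) →ₗ[ℂ] ChainOp d (n + 2),
      (∀ W, ‖Ψ W - W‖ ≤ ((1 + siteError d m s ε) ^ (i + 1) - 1) * ‖W‖) ∧
      ∀ X, ∃ V ∈ supported d (block (n + 2) (k + 2) (n + 2)),
        Ψ (chainProd X Finset.univ) = chainProd X (block (n + 2) 1 (k + 1)) * V ∧
        reconValue svd η E X = ∑ p, ∑ b, kProd svd η E X k p b *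
          expect ρ (rowOp (frame svd η E (k + 1))ᴴ b * V) := by
  induction i with
  | zero =>
    rintro k rfl
    exact hybrid_last hρ hE hε hs hs1 hm hcuts
  | succ i ih =>
    intro k hk
    obtain ⟨Ψ, hΨn, hΨ⟩ := ih (k + 1) (by omega)
    obtain ⟨R, hR⟩ := hcuts k (by omega)
    obtain ⟨R', hR'⟩ := hcuts (k + 1) (by omega)
    obtain ⟨Φ, hΦn, hΦ⟩ := exists_mid_step hρ hE hε hs hs1 (by omega) hR hR'
    have hn := norm_perturbation_sub_le (siteError_nonneg hε hs) hΦn hΨn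
    refine ⟨_, hn, fun X => ?_⟩
    obtain ⟨V, hV, hΨV, hrec⟩ := hΨ X
    obtain ⟨V', hV', hYV, hval⟩ := hΦ (chainProd X (block (n + 2) 1 (k + 1)))
      (embed_mem_supported _ _) (prodOp X (block (n + 2) (k + 2) (k + 2))) V hV
    refine ⟨V', hV', ?_, ?_⟩
    · rw [LinearMap.comp_apply, hΨV, chainProd_univ_split]
      exact hYV
    · rw [hrec]
      refine Finset.sum_congr rfl fun p _ => ?_
      simp only [hval, Finset.mul_sum]
      rw [Finset.sum_comm]
      refine Finset.sum_congr rfl fun b _ => ?_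
      rw [kProd, Matrix.mul_apply, Finset.sum_mul]
      exact Finset.sum_congr rfl fun a _ => mul_assoc _ _ _

theorem exists_first_step (hρ : IsState ρ) (hE : IsEstimate ρ ε E) (hε : 0 < ε) (hs : 0 < s)
    (hs1 : s ≤ 1) (hm : 1 ≤ m)
    {R : Matrix (OpIdx d (rightWin (n + 2) r 1)) (Kept svd η E 1) ℂ}
    (hR : CutBound ρ svd η E m s 1 R) :
    ∃ Φ : ChainOp d (n + 2) →ₗ[ℂ] ChainOp d (n + 2),
      (∀ W, ‖Φ W‖ ≤ siteError d m s ε * ‖W‖) ∧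
      ∀ A, ∀ V ∈ supported d (block (n + 2) 2 (n + 2)), ∃ V',
          embed (block (n + 2) 1 1) A * V + Φ (embed (block (n + 2) 1 1) A * V) = V' ∧
          ∀ a, expect ρ V'
            = ∑ b, kFirst svd η E A a b * expect ρ (rowOp (frame svd η E 1)ᴴ b * V) := by
  have hempty : leftWin (n + 2) l 0 = ∅ := leftWin_zero _ _
  have hone : ‖(1 : ChainOp d (n + 2))‖ ≤ 1 := opNorm_le_one_of_isometry (by simp)
  obtain ⟨Φ, hΦn, hΦ⟩ := exists_step (k := 0) (c := 2 / s) (κ := 7 * ε / s ^ 2) hρ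
    (Nat.succ_pos _) ((card_opIdx_of_eq_empty hempty).trans_le hm) hR.card_le (by positivity)
    (by positivity)
    (rowOp (1 : Matrix (OpIdx d (leftWin (n + 2) l 0)) (OpIdx d (leftWin (n + 2) l 0)) ℂ))
    (fun _ => 1)
    -- At the first site the dual operator is the identity; its norm `1` is within the common bound
    -- `2 / s` since `s ≤ 1`.
    (fun _ => hone.trans (by rw [le_div_iff₀ hs]; linarith))
    (fun _ => one_mem_supported _)
    (fun a a' => by
      have haa' : a = a' := by
        have h := card_opIdx_of_eq_empty (d := d) hempty
        exact (Fintype.card_le_one_iff_subsingleton.1 h.le).elim a a'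
      rw [rowOp_one_of_eq_empty hempty, Matrix.mul_one, expect_one hρ, if_pos haa'])
    (rowOp (frame svd η E 1)ᴴ)
    (fun b => (norm_rowOp_le _ b).trans (norm_frame_conjTranspose_le svd η E 1))
    (transferLin (marginals l r ρ) 0 1 R)
    (transferLin E 0 1 (framePinv svd η E 1))
    (fun A a V hV => hR.expect_transfer _ A a hV)
    (hR.sum_frobSq_transfer_sub_le hρ hε hs hs1 (hE.1 _ (by omega)) (hE.2 _ (by omega))
      (opNorm_le_one_of_isometry (by simp)))
  refine ⟨Φ, hΦn, fun A V hV => ?_⟩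
  obtain ⟨V', -, hYV, hval⟩ := hΦ 1 (one_mem_supported _) A V hV
  rw [Matrix.one_mul, Matrix.one_mul] at hYV
  refine ⟨V', hYV, fun a => ?_⟩
  have h := hval a
  rw [rowOp_one_of_eq_empty hempty, Matrix.one_mul, transferLin_apply, Matrix.one_mul] at h
  exact h

theorem exists_hybrid (hρ : IsState ρ) (hE : IsEstimate ρ ε E) (hε : 0 < ε) (hs : 0 < s)
    (hs1 : s ≤ 1) (hm : 1 ≤ m) (hcuts : ∀ j ≤ n, ∃ R, CutBound ρ svd η E m s (j + 1) R) :
    ∃ Ψ : ChainOp d (n + 2) →ₗ[ℂ] ChainOp d (n + 2),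
      (∀ W, ‖Ψ W - W‖ ≤ ((1 + siteError d m s ε) ^ (n + 2) - 1) * ‖W‖) ∧
      ∀ X, reconValue svd η E X = expect ρ (Ψ (chainProd X Finset.univ)) := by
  obtain ⟨Ψ, hΨn, hΨ⟩ := hybrid_mid hρ hE hε hs hs1 hm hcuts n 0 (zero_add n)
  obtain ⟨R, hR⟩ := hcuts 0 (Nat.zero_le n)
  obtain ⟨Φ, hΦn, hΦ⟩ := exists_first_step hρ hE hε hs hs1 hm hR
  have hn := norm_perturbation_sub_le (siteError_nonneg hε hs) hΦn hΨn
  refine ⟨_, hn, fun X => ?_⟩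
  obtain ⟨V, hV, hΨV, hrec⟩ := hΨ X
  obtain ⟨V', hYV, hval⟩ := hΦ (prodOp X (block (n + 2) 1 1)) V hV
  rw [hrec, LinearMap.comp_apply, hΨV]
  refine Eq.trans ?_ (congrArg (expect ρ) hYV).symm
  exact sum_opIdx_of_eq_empty (leftWin_zero _ _) fun p => (hval p).symm

/-- Matrix units of the chain are product operators, and both sides are linear in `W`, so agreement
on products is enough. -/
theorem trace_recon_mul_eq {Ψ : ChainOp d (n + 2) →ₗ[ℂ] ChainOp d (n + 2)}
    (h : ∀ X, reconValue svd η E X = expect ρ (Ψ (chainProd X Finset.univ)))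
    (W : ChainOp d (n + 2)) : (recon svd η E * W).trace = expect ρ (Ψ W) := by
  have hW : W = ∑ t, ∑ s, W t s • Matrix.single t s (1 : ℂ) := by
    conv_lhs => rw [matrix_eq_sum_single W]
    simp [Matrix.smul_single]
  have h1 : expect ρ (Ψ W) = ∑ t, ∑ s, W t s * recon svd η E s t := by
    conv_lhs => rw [hW]
    simp only [map_sum, map_smul, smul_eq_mul]
    refine Finset.sum_congr rfl fun t _ => Finset.sum_congr rfl fun s _ => ?_
    rw [← chainProd_univ_single, ← h]
    rfl
  rw [h1, Finset.sum_comm, trace]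
  refine Finset.sum_congr rfl fun s _ => ?_
  rw [diag_apply, Matrix.mul_apply]
  exact Finset.sum_congr rfl fun t _ => mul_comm _ _

theorem traceDist_recon_le (hρ : IsState ρ) (hE : IsEstimate ρ ε E) (hε : 0 < ε) (hs : 0 < s)
    (hs1 : s ≤ 1) (hm : 1 ≤ m) (hcuts : ∀ j ≤ n, ∃ R, CutBound ρ svd η E m s (j + 1) R) :
    traceDist (recon svd η E) ρ ≤ ((1 + siteError d m s ε) ^ (n + 2) - 1) / 2 := by
  obtain ⟨Ψ, hΨn, hΨ⟩ := exists_hybrid hρ hE hε hs hs1 hm hcuts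
  have hΔ : 0 ≤ siteError d m s ε := siteError_nonneg hε hs
  have h0 : 0 ≤ (1 + siteError d m s ε) ^ (n + 2) - 1 :=
    sub_nonneg.2 (one_le_pow₀ (by linarith))
  refine div_le_div_of_nonneg_right (Real.sSup_le ?_ h0) zero_le_two
  rintro _ ⟨X, hX, rfl⟩
  rw [Matrix.sub_mul, trace_sub, trace_recon_mul_eq hΨ, ← expect_apply, ← map_sub]
  exact (norm_expect_le hρ _).trans ((hΨn X).trans (mul_le_of_le_one_right h0 hX))

end Hybrid

/-! ### Choice of constants -/

section Constants

/-- With `x = 7 err / 10 ≤ 1`, the power is at most `exp x ≤ 1 + x + x²`, and `0.7 err + 0.49 err² ≤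
2 err`. -/
theorem one_add_pow_sub_one_le {N : ℕ} {Δ err : ℝ} (h0 : 0 < err) (h1 : err < 1)
    (hΔ0 : 0 ≤ Δ) (hΔ : Δ * N ≤ 7 / 10 * err) : (1 + Δ) ^ N - 1 ≤ 2 * err := by
  have h2 : (1 + Δ) ^ N ≤ Real.exp (7 / 10 * err) := by
    calc (1 + Δ) ^ N ≤ Real.exp Δ ^ N :=
          pow_le_pow_left₀ (by linarith) (by linarith [Real.add_one_le_exp Δ]) N
      _ = Real.exp (Δ * N) := by rw [← Real.exp_nat_mul, mul_comm]
      _ ≤ _ := Real.exp_le_exp.2 hΔ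
  have h3 := Real.abs_exp_sub_one_sub_id_le (x := 7 / 10 * err)
    (by rw [abs_le]; constructor <;> linarith)
  have h4 := (abs_le.1 h3).2
  nlinarith

theorem IsState.local_dim_pos {d N : ℕ} (hN : 2 ≤ N) {ρ : ChainOp d N} (hρ : IsState ρ) :
    0 < d := by
  rcases Nat.eq_zero_or_pos d with rfl | h
  · have : IsEmpty (Fin N → Fin 0) := ⟨fun f => (f ⟨0, by omega⟩).elim0⟩
    have h1 := hρ.2
    rw [trace, Finset.univ_eq_empty, Finset.sum_empty] at h1
    exact absurd h1 zero_ne_one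
  · exact h

theorem traceDist_recon_le_of_isEstimate (d N l r m : ℕ) (hN : 2 ≤ N)
    (ρ : ChainOp d N) (hρ : IsState ρ) (hfc : IsFinitelyCorrelated l r m ρ)
    (err ε η : ℝ) (herr0 : 0 < err) (herr1 : err < 1)
    (hε : IsLeast ((fun j : ℕ => err * sigmaCut l r ρ j ^ 3 /
      (20 * N * m * Real.sqrt d)) '' Set.Icc 1 N) ε)
    (hησ : ∀ j ≤ N, η ≤ sigmaCut l r ρ j / 2) (hεη : 2 * ε ≤ η)
    (svd : SVDRoutine d N l r) (E : LocalData d N l r) (hE : IsEstimate ρ ε E) :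
    traceDist (recon svd η E) ρ ≤ err := by
  obtain ⟨⟨j₀, -, hεj⟩, hmin⟩ := hε
  have hd : (0 : ℝ) < √d := Real.sqrt_pos.2 (by exact_mod_cast hρ.local_dim_pos hN)
  have hm : 1 ≤ m :=
    (Nat.one_le_iff_ne_zero.2 (rank_omega_ne_zero hρ 0)).trans (hfc 0 (Nat.zero_le N)).2
  have hm' : (0 : ℝ) < m := by exact_mod_cast hm
  have hN' : (0 : ℝ) < N := by exact_mod_cast (by omega : 0 < N)
  set s := sigmaCut l r ρ j₀ with hs
  have hs0 : 0 < s := sigmaCut_pos hρ j₀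
  have hs1 : s ≤ 1 := sigmaCut_le_one hρ j₀
  have hε0 : 0 < ε := by rw [← hεj]; positivity
  -- The precision is increasing in `σ_j`, so the index that attains the minimum `ε` also minimises
  -- `σ_j` over `1 ≤ j ≤ N`. The reconstruction uses only the cuts `1, …, N - 1`.
  have hsmin : ∀ j, 1 ≤ j → j ≤ N → s ≤ sigmaCut l r ρ j := by
    intro j h1 h2
    have h3 := hmin ⟨j, ⟨h1, h2⟩, rfl⟩
    rw [← hεj] at h3
    dsimp only at h3
    rw [div_le_div_iff_of_pos_right (by positivity)] at h3
    exact le_of_pow_le_pow_left₀ three_ne_zero (sigmaCut_pos hρ j).le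
      (le_of_mul_le_mul_left h3 herr0)
  -- In fact an equality: `2 · 7 · m √d ε N / s³ = (14/20) err`.
  have hΔ : siteError d m s ε * N ≤ 7 / 10 * err := by
    rw [siteError, ← hεj]
    dsimp only
    rw [← hs]
    refine le_of_eq ?_
    field_simp
    norm_num
  obtain ⟨n, rfl⟩ : ∃ n, N = n + 2 := ⟨N - 2, by omega⟩
  have hcuts : ∀ j ≤ n, ∃ R, CutBound ρ svd η E m s (j + 1) R := fun j hj =>
    exists_cutBound hfc svd (by omega) hε0 hs0 (hsmin _ (by omega) (by omega)) hεη
      (hησ _ (by omega)) (hE.1 _ (by omega))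
  refine (traceDist_recon_le hρ hE hε0 hs0 hs1 hm hcuts).trans ?_
  have := one_add_pow_sub_one_le (N := n + 2) herr0 herr1
    (siteError_nonneg hε0 hs0) hΔ
  linarith

end Constants

end FinChain

theorem mainTheorem6 (d N l r m : ℕ) (hN : 2 ≤ N)
    (ρ : FinChain.ChainOp d N) (hρ : FinChain.IsState ρ)
    (hfc : FinChain.IsFinitelyCorrelated l r m ρ)
    (err ε η : ℝ) (herr0 : 0 < err) (herr1 : err < 1)
    (hε : IsLeast ((fun j : ℕ => err * FinChain.sigmaCut l r ρ j ^ 3 /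
      (20 * N * m * Real.sqrt d)) '' Set.Icc 1 N) ε)
    (hησ : ∀ j ≤ N, η ≤ FinChain.sigmaCut l r ρ j / 2) (hεη : 2 * ε ≤ η)
    (svd : FinChain.SVDRoutine d N l r) :
    (∀ E : FinChain.LocalData d N l r, FinChain.IsEstimate ρ ε E →
      FinChain.traceDist (FinChain.recon svd η E) ρ ≤ err) ∧
    ∀ (n : ℕ) (T : FinChain.LocalMeasurement d N l r n)
      (est : Fin T.outcomes → FinChain.LocalData d N l r) (δ : ℝ),
      1 - δ ≤ T.prob ρ (fun x => FinChain.IsEstimate ρ ε (est x)) →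
      1 - δ ≤ T.prob ρ (fun x =>
        FinChain.traceDist (FinChain.recon svd η (est x)) ρ ≤ err) := by
  have h := FinChain.traceDist_recon_le_of_isEstimate d N l r m hN ρ hρ hfc err ε η herr0 herr1
    hε hησ hεη svd
  -- The event that the estimates are accurate is contained in the event that the reconstruction is.
  exact ⟨h, fun n T est δ hδ => hδ.trans (T.prob_mono hρ fun x => h (est x))⟩
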